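/- Let $(R,\mathcal M)$ be a commutative discrete valuation ring with maximal ideal $\mathcal M$ that is complete in its $\mathcal M$-adic topology and has a finite residue field of characteristic $p$; let $\mathbb K$ be its field of fractions. Fix $c\in(0,1)$ and put $\|a\|=c^n$ for $a\in\mathcal M^n\setminus\mathcal M^{n+1}$, $\|0\|=0$. A formal group law of dimension $d$ over $R$ is a tuple $F=(F_1,\dots,F_d)$ of formal power series $F_i\in R[[X_1,\dots,X_d,Y_1,\dots,Y_d]]$ with $F(X,0)=X$, $F(0,Y)=Y$ and $F(X,F(Y,Z))=F(F(X,Y),Z)$. An $R$-standard group of dimension $d$ is a topological group $G$ with underlying space $\mathcal M^{(d)}=\mathcal M\times\cdots\times\mathcal M$ ($d$ factors) whose multiplication is $g\cdot h=F(g,h)$ for such an $F$. Write $F(X,Y)=X+Y+B(X,Y)+(\text{terms of total degree}\ge 3)$ with $B$ bilinear. The Lie algebra of $G$ is $\mathcal L_G=\mathcal M^{(d)}\otimes_R\mathbb K$ with the $\mathbb K$-bilinear extension of the bracket $(v,w)=B(v,w)-B(w,v)$; it is perfect if it is spanned over $\mathbb K$ by its brackets. Let $G$ be a $d$-dimensional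 $R$-standard group with $\mathcal L_G$ perfect, let $x_1,\dots,x_d$ be an $R$-basis of $\mathcal M^{(d)}$, and let $S\subseteq G$ be a finite non-empty symmetric set ($S=S^{-1}$) that generates a dense subgroup of $G$. If $p=2$, assume moreover that $S$ meets every open subgroup of index $2$ in $G$ (for instance, $1\in S$). Let $X_1,X_2,\dots$ be independent random variables, uniformly distributed on $S$, let $Y_l=X_1\cdots X_l$ be the simple random walk, and define the $R$-valued random variables $L^{(l)}_1,\dots,L^{(l)}_d$ by $Y_l=L^{(l)}_1x_1+\cdots+L^{(l)}_dx_d$ in $\mathcal M^{(d)}$. Then there exists $C=C(d)>0$ such that for every $C'>0$ there exist $C''=C''(G,|S|,C')>0$ and $C'''=C'''(d,|R/\mathcal M|,C')>0$ such that for all $(\lambda_1,\dots,\lambda_d)\in R^{(d)}$ and all $N\in\mathbb N$, $$\Big|\,\mathbb P\big[\|L^{(l)}_i-\lambda_i\|\le c^{N}\text{ for all }1\le i\le d\big]-\frac1{|R/\mathcal M|^{dN}}\Big|\le e^{-C'''N^{C'}}\qquad\text{whenever } l\ge C''N^{C+C'}.$$ Here each constant depends only on the data displayed in its parentheses: $C$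 on $d$ alone, and $C''$ on $S$ only through $|S|$ (and not on $x_1,\dots,x_d$, $c$, the $\lambda_i$ or $N$). -/

import Mathlib

open MeasureTheory ProbabilityTheory
open scoped TensorProduct

namespace RStandard

/-- A formal group law of dimension `d` over `R`: a `d`-tuple of formal power series
`F = (F₁, …, F_d)` in the `2d` variables `X₁, …, X_d` (indexed by `Sum.inl`) and
`Y₁, …, Y_d` (indexed by `Sum.inr`), with `F(X, 0) = X`, `F(0, Y) = Y` and
`F(X, F(Y, Z)) = F(F(X, Y), Z)`. In the associativity law, the variables `X`, `Y`, `Z` are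
indexed by the three summands `Sum.inl j`, `Sum.inr (Sum.inl j)`, `Sum.inr (Sum.inr j)`. -/
structure FormalGroupLaw (R : Type*) [CommRing R] (d : ℕ) where
  /-- The components of the formal group law. -/
  series : Fin d → MvPowerSeries (Fin d ⊕ Fin d) R
  /-- `F(X, 0) = X`. -/
  right_zero : ∀ i, MvPowerSeries.subst
    (Sum.elim (fun j => (MvPowerSeries.X j : MvPowerSeries (Fin d) R)) (fun _ => 0))
    (series i) = MvPowerSeries.X i
  /-- `F(0, Y) = Y`. -/
  left_zero : ∀ i, MvPowerSeries.subst
    (Sum.elim (fun _ => 0) (fun j => (MvPowerSeries.X j : MvPowerSeries (Fin d) R)))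
    (series i) = MvPowerSeries.X i
  /-- `F(X, F(Y, Z)) = F(F(X, Y), Z)`. -/
  assoc : ∀ i,
    MvPowerSeries.subst
      (Sum.elim
        (fun j => (MvPowerSeries.X (Sum.inl j) : MvPowerSeries (Fin d ⊕ Fin d ⊕ Fin d) R))
        (fun j => MvPowerSeries.subst
          (Sum.elim
            (fun k => (MvPowerSeries.X (Sum.inr (Sum.inl k)) :
              MvPowerSeries (Fin d ⊕ Fin d ⊕ Fin d) R))
            (fun k => MvPowerSeries.X (Sum.inr (Sum.inr k))))
          (series j)))
      (series i) =
    MvPowerSeries.subst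
      (Sum.elim
        (fun j => MvPowerSeries.subst
          (Sum.elim
            (fun k => (MvPowerSeries.X (Sum.inl k) :
              MvPowerSeries (Fin d ⊕ Fin d ⊕ Fin d) R))
            (fun k => MvPowerSeries.X (Sum.inr (Sum.inl k))))
          (series j))
        (fun j => (MvPowerSeries.X (Sum.inr (Sum.inr j)) :
          MvPowerSeries (Fin d ⊕ Fin d ⊕ Fin d) R)))
      (series i)

/-- The space `𝓜^(d)` of `d`-tuples of elements of the maximal ideal of `R`. -/
abbrev MaxTuple (R : Type*) [CommRing R] [IsLocalRing R] (d : ℕ) : Type _ :=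
  Fin d → IsLocalRing.maximalIdeal R

/-- An `R`-standard group structure of dimension `d` on a topological group `G`: an identification
of the space `G` with `𝓜^(d)` under which the multiplication is given by (the convergent
evaluation of) a formal group law of dimension `d`. (`R` is meant to carry its `𝓜`-adic
topology.) -/
structure StandardStructure (R : Type*) [CommRing R] [IsLocalRing R] [TopologicalSpace R]
    (d : ℕ) (G : Type*) [Group G] [TopologicalSpace G] where
  /-- The formal group law. -/
  law : FormalGroupLaw R d
  /-- The identification of `G` with `𝓜^(d)`. -/
  coord : G ≃ₜ MaxTuple R d
  /-- `g · h = F(g, h)`. -/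
  hasSum_mul : ∀ (g h : G) (i : Fin d),
    HasSum
      (fun m : (Fin d ⊕ Fin d) →₀ ℕ =>
        MvPowerSeries.coeff m (law.series i) *
          m.prod (fun v e => (Sum.elim (fun j => (coord g j : R)) (fun j => (coord h j : R)) v) ^ e))
      (coord (g * h) i : R)

section Lie

variable {R : Type*} [CommRing R] {d : ℕ}

/-- The coefficient of `X_j Y_k` in the `i`-th component of the formal group law. -/
noncomputable def FormalGroupLaw.quadCoeff (F : FormalGroupLaw R d) (i j k : Fin d) : R :=
  MvPowerSeries.coeff (Finsupp.single (Sum.inl j) 1 + Finsupp.single (Sum.inr k) 1) (F.series i)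

/-- The bilinear part `B` of the formal group law `F(X, Y) = X + Y + B(X, Y) + …`,
evaluated on `𝓜^(d)`. -/
noncomputable def FormalGroupLaw.bilin [IsLocalRing R] (F : FormalGroupLaw R d) :
    MaxTuple R d →ₗ[R] MaxTuple R d →ₗ[R] MaxTuple R d :=
  LinearMap.mk₂ R
    (fun v w i => ∑ j, ∑ k, (F.quadCoeff i j k * (v j : R)) • w k)
    (fun v v' w => by
      funext i
      simp [mul_add, add_smul, Finset.sum_add_distrib])
    (fun a v w => by
      funext i
      simp only [Pi.smul_apply, Finset.smul_sum, smul_smul, Submodule.coe_smul, smul_eq_mul]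
      refine Finset.sum_congr rfl fun j _ => Finset.sum_congr rfl fun k _ => ?_
      congr 1
      ring)
    (fun v w w' => by
      funext i
      simp [smul_add, Finset.sum_add_distrib])
    (fun a v w => by
      funext i
      simp only [Pi.smul_apply, Finset.smul_sum]
      refine Finset.sum_congr rfl fun j _ => Finset.sum_congr rfl fun k _ => ?_
      rw [smul_comm])

/-- The Lie bracket `(v, w) = B(v, w) - B(w, v)` of the `R`-Lie ring `L(G) = 𝓜^(d)`. -/
noncomputable def FormalGroupLaw.bracket [IsLocalRing R] (F : FormalGroupLaw R d) :
    MaxTuple R d →ₗ[R] MaxTuple R d →ₗ[R] MaxTuple R d :=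
  F.bilin - F.bilin.flip

/-- The Lie bracket of the Lie algebra `𝓛_G = 𝕂 ⊗_R L(G)`, with `𝕂` the field of fractions
of `R`: the `𝕂`-bilinear extension of the bracket of `L(G)`. -/
noncomputable def FormalGroupLaw.lieAlgBracket [IsLocalRing R] (F : FormalGroupLaw R d) :
    (FractionRing R ⊗[R] MaxTuple R d) →ₗ[FractionRing R]
      (FractionRing R ⊗[R] MaxTuple R d) →ₗ[FractionRing R]
        (FractionRing R ⊗[R] MaxTuple R d) :=
  LinearMap.BilinMap.baseChange (FractionRing R) F.bracket

/-- The Lie algebra `𝓛_G` is perfect: it is equal to its derived subalgebra, the `𝕂`-span of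
all brackets. -/
def FormalGroupLaw.LiePerfect [IsLocalRing R] (F : FormalGroupLaw R d) : Prop :=
  Submodule.span (FractionRing R) {z | ∃ x y, F.lieAlgBracket x y = z} = ⊤

end Lie

section Norm

variable {R : Type*} [CommRing R] [IsLocalRing R]

open Classical in
/-- The norm `‖a‖ = c ^ n` for `a ∈ 𝓜 ^ n \ 𝓜 ^ (n + 1)`, and `‖0‖ = 0`. -/
noncomputable def adicNorm (c : ℝ) (a : R) : ℝ :=
  if a = 0 then 0 else c ^ sSup {n : ℕ | a ∈ IsLocalRing.maximalIdeal R ^ n}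

theorem adicNorm_zero (c : ℝ) : adicNorm c (0 : R) = 0 := by
  simp [adicNorm]

theorem adicNorm_eq (c : ℝ) {a : R} {n : ℕ} (h : a ∈ IsLocalRing.maximalIdeal R ^ n)
    (h' : a ∉ IsLocalRing.maximalIdeal R ^ (n + 1)) : adicNorm c a = c ^ n := by
  have ha : a ≠ 0 := by
    rintro rfl
    exact h' (zero_mem _)
  have hg : IsGreatest {n : ℕ | a ∈ IsLocalRing.maximalIdeal R ^ n} n := by
    refine ⟨h, fun m hm => ?_⟩
    by_contra hlt
    exact h' (Ideal.pow_le_pow_right (by omega) hm)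
  rw [adicNorm, if_neg ha, hg.csSup_eq]

end Norm

/-- The simple random walk at time `l` driven by the steps `X 0, X 1, …`:
`Y_l = X 0 * X 1 * ⋯ * X (l - 1)`. -/
def walk {Ω G : Type*} [Group G] (X : ℕ → Ω → G) (l : ℕ) (ω : Ω) : G :=
  (List.ofFn fun i : Fin l => X i ω).prod

end RStandard

/-!
The event says that the walk at time `l` lies in a given coset of the congruence subgroup of level
`N + 1`, whose index in `G` is `q ^ (d * N)`. The estimate is thus one on the mixing of a random
walk on a finite quotient of `G`, and it follows from a polylogarithmic bound on the diameters of
these quotients.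

Diameters (`StandardStructure.exists_covers_step`, `StandardStructure.exists_covers`) are bounded by
the method of Solovay and Kitaev. To leading order the commutator of two elements is the bracket of
their coordinates (`StandardStructure.coord_commutator_sub_bracket_mem`). As the Lie algebra is
perfect, there are a basis `e` of the Lie ring and an `s` such that each vector divisible by `ϖ ^ s`
is a sum of `d` brackets with the `e j` (`FormalGroupLaw.LiePerfect.exists_pow_smul_eq_sum`), and
powers of `ϖ` can be moved from one entry of a bracket to the other. An element of level `n` is
therefore, with precision about `3 * n / 2`, a product of `d` commutators of elements of level about
`n / 2`. Changing these elements at level `n` changes the commutators at level about `3 * n / 2`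
only. So if words of length `ℓ` represent `G` with precision `n`, then words of length
`(4 * d + 1) * ℓ` represent it with precision `n + n / 4`. Iterating, the length is at most a
constant times a power of `n` whose exponent depends on `d` only. The iteration starts in one
fixed finite quotient of `G`, so that the constant is uniform in the generating set.

The words are in the elements of `S * S`. These generate the finite quotients, because `G` is a
pro-`p` group: for odd `p` it has no open subgroup of index two, and for `p = 2` the hypothesis
excludes the relevant ones (`closure_image_mul_self_eq_top`).

Mixing (`norm_avgOp_sq_le`, `abs_card_walk_sub_le`): a function with mean zero on a finite group is
moved by some translation by at least its norm times `√2`. If each translation is a product of `D`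
translations by elements `s⁻¹ * t` with `s, t` in `S`, one of these moves the function by the
fraction `1 / D` of this, so that the squared norm of the average of its translates by `S` is
smaller by a factor `1 - 1 / (|S| * D) ^ 2`.
-/

namespace RStandard

open scoped Pointwise

/-! ### Coefficients of a formal group law and convergence -/

/-- Substituting distinct variables for some of the variables of a power series, and `0` for the
others, keeps the coefficients of the monomials in the former. -/
theorem coeff_subst_of_injective {R σ τ : Type*} [CommRing R] [Finite σ] {φ : τ → σ}
    (hφ : Function.Injective φ) {a : σ → MvPowerSeries τ R}
    (ha : ∀ j, a (φ j) = MvPowerSeries.X j) (ha0 : ∀ v, v ∉ Set.range φ → a v = 0)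
    (f : MvPowerSeries σ R) (e : τ →₀ ℕ) :
    MvPowerSeries.coeff e (MvPowerSeries.subst a f) =
      MvPowerSeries.coeff (e.mapDomain φ) f := by
  have hsub : MvPowerSeries.HasSubst a := by
    refine MvPowerSeries.hasSubst_of_constantCoeff_zero fun v => ?_
    by_cases hv : v ∈ Set.range φ
    · obtain ⟨j, rfl⟩ := hv
      simp [ha]
    · simp [ha0 v hv]
  have key : ∀ e' : τ →₀ ℕ, (e'.mapDomain φ).prod (fun v n => a v ^ n) =
      MvPowerSeries.monomial e' (1 : R) := by
    intro e'
    rw [Finsupp.prod_mapDomain_index_inj hφ, MvPowerSeries.monomial_one_eq]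
    simp [ha]
  rw [MvPowerSeries.coeff_subst hsub, finsum_eq_single _ (e.mapDomain φ)]
  · simp [key]
  · intro m hm
    by_cases h : ∀ v ∈ m.support, v ∈ Set.range φ
    · have hme : (m.comapDomain φ hφ.injOn).mapDomain φ = m :=
        Finsupp.mapDomain_comapDomain φ hφ m (fun v hv => h v hv)
      rw [← hme, key, MvPowerSeries.coeff_monomial_ne, smul_zero]
      rintro rfl
      exact hm hme.symm
    · push Not at h
      obtain ⟨v, hv, hvr⟩ := h
      have : m.prod (fun v n => a v ^ n) = 0 := by
        refine Finset.prod_eq_zero hv ?_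
        simp [ha0 v hvr, Finsupp.mem_support_iff.1 hv]
      simp [this]

namespace FormalGroupLaw

variable {R : Type*} [CommRing R] {d : ℕ} (F : FormalGroupLaw R d)

theorem coeff_mapDomain_inl (i : Fin d) (e : Fin d →₀ ℕ) :
    MvPowerSeries.coeff (e.mapDomain Sum.inl) (F.series i) =
      MvPowerSeries.coeff e (MvPowerSeries.X i : MvPowerSeries (Fin d) R) := by
  rw [← F.right_zero i]
  refine (coeff_subst_of_injective Sum.inl_injective (fun j => rfl) (fun v hv => ?_) _ e).symm
  rcases v with j | j
  · exact absurd ⟨j, rfl⟩ hv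
  · rfl

theorem coeff_mapDomain_inr (i : Fin d) (e : Fin d →₀ ℕ) :
    MvPowerSeries.coeff (e.mapDomain Sum.inr) (F.series i) =
      MvPowerSeries.coeff e (MvPowerSeries.X i : MvPowerSeries (Fin d) R) := by
  rw [← F.left_zero i]
  refine (coeff_subst_of_injective Sum.inr_injective (fun j => rfl) (fun v hv => ?_) _ e).symm
  rcases v with j | j
  · rfl
  · exact absurd ⟨j, rfl⟩ hv

/-- Every monomial of `F_i` other than `X_i` and `Y_i` involves both groups of variables. -/
theorem exists_of_coeff_ne_zero (i : Fin d) {m : (Fin d ⊕ Fin d) →₀ ℕ}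
    (h : MvPowerSeries.coeff m (F.series i) ≠ 0)
    (h₁ : m ≠ Finsupp.single (Sum.inl i) 1) (h₂ : m ≠ Finsupp.single (Sum.inr i) 1) :
    ∃ j k m', m = Finsupp.single (Sum.inl j) 1 + Finsupp.single (Sum.inr k) 1 + m' := by
  classical
  have hl : ∃ j, m (Sum.inl j) ≠ 0 := by
    by_contra! hc
    have hm : (m.comapDomain Sum.inr Sum.inr_injective.injOn).mapDomain Sum.inr = m := by
      refine Finsupp.mapDomain_comapDomain _ Sum.inr_injective m fun v hv => ?_
      rcases v with j | j
      · exact absurd (hc j) (Finsupp.mem_support_iff.1 hv)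
      · exact ⟨j, rfl⟩
    rw [← hm, coeff_mapDomain_inr, MvPowerSeries.coeff_X] at h
    have he := (ite_ne_right_iff.1 h).1
    rw [he, Finsupp.mapDomain_single] at hm
    exact h₂ hm.symm
  have hr : ∃ k, m (Sum.inr k) ≠ 0 := by
    by_contra! hc
    have hm : (m.comapDomain Sum.inl Sum.inl_injective.injOn).mapDomain Sum.inl = m := by
      refine Finsupp.mapDomain_comapDomain _ Sum.inl_injective m fun v hv => ?_
      rcases v with j | j
      · exact ⟨j, rfl⟩
      · exact absurd (hc j) (Finsupp.mem_support_iff.1 hv)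
    rw [← hm, coeff_mapDomain_inl, MvPowerSeries.coeff_X] at h
    have he := (ite_ne_right_iff.1 h).1
    rw [he, Finsupp.mapDomain_single] at hm
    exact h₁ hm.symm
  obtain ⟨j, hj⟩ := hl
  obtain ⟨k, hk⟩ := hr
  have hle : Finsupp.single (Sum.inl j) 1 + Finsupp.single (Sum.inr k) 1 ≤ m := by
    intro v
    rcases v with v | v
    · simp only [Finsupp.add_apply, Finsupp.single_apply]
      by_cases hv : v = j
      · subst hv; simp; omega
      · simp [Ne.symm hv]
    · simp only [Finsupp.add_apply, Finsupp.single_apply]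
      by_cases hv : v = k
      · subst hv; simp; omega
      · simp [Ne.symm hv]
  exact ⟨j, k, m - _, (add_tsub_cancel_of_le hle).symm⟩

theorem coeff_single_inl (i : Fin d) :
    MvPowerSeries.coeff (Finsupp.single (Sum.inl i) 1) (F.series i) = 1 := by
  have := F.coeff_mapDomain_inl i (Finsupp.single i 1)
  rwa [Finsupp.mapDomain_single, MvPowerSeries.coeff_index_single_self_X] at this

theorem coeff_single_inr (i : Fin d) :
    MvPowerSeries.coeff (Finsupp.single (Sum.inr i) 1) (F.series i) = 1 := by
  have := F.coeff_mapDomain_inr i (Finsupp.single i 1)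
  rwa [Finsupp.mapDomain_single, MvPowerSeries.coeff_index_single_self_X] at this

end FormalGroupLaw

/-- The sum of a convergent series is congruent to a finite partial sum modulo any power of the
ideal containing all the other terms. -/
theorem sub_sum_mem_of_hasSum {R ι : Type*} [CommRing R] [TopologicalSpace R] {I : Ideal R}
    (hI : IsAdic I) {f : ι → R} {x : R} (hf : HasSum f x) (s : Finset ι) (n : ℕ)
    (h : ∀ i ∉ s, f i ∈ I ^ n) : x - ∑ i ∈ s, f i ∈ I ^ n := by
  classical
  have hev : ∀ᶠ t in Filter.atTop,
      (∑ i ∈ t, f i) ∈ ((fun y => x + y) '' (I ^ n : Ideal R) : Set R) :=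
    hf ((hI.hasBasis_nhds x).mem_of_mem trivial)
  obtain ⟨t, ⟨y, hy, hyt⟩, hst⟩ := (hev.and (Filter.eventually_ge_atTop s)).exists
  have h1 : ∑ i ∈ t \ s, f i ∈ I ^ n :=
    Ideal.sum_mem _ fun i hi => h i (Finset.mem_sdiff.1 hi).2
  have h2 := Finset.sum_sdiff (f := f) hst
  have : x - ∑ i ∈ s, f i = ∑ i ∈ t \ s, f i - y := by
    rw [← hyt] at h2
    linear_combination -h2
  rw [this]
  exact sub_mem h1 hy

/-! ### The filtration of the Lie ring by powers of the maximal ideal -/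

/-- The submodule of `𝓜^(d)` of the tuples with all entries in `𝓜 ^ n`. The indices `0` and `1`
both give the whole of `𝓜^(d)`. -/
def filt (R : Type*) [CommRing R] [IsLocalRing R] (d n : ℕ) : Submodule R (MaxTuple R d) where
  carrier := {v | ∀ i, (v i : R) ∈ IsLocalRing.maximalIdeal R ^ n}
  add_mem' := fun hv hw i => add_mem (hv i) (hw i)
  zero_mem' := fun _ => zero_mem _
  smul_mem' := fun a _ hv i => Ideal.mul_mem_left _ a (hv i)

section Filt

variable {R : Type*} [CommRing R] [IsLocalRing R] {d : ℕ}

theorem mem_filt {n : ℕ} {v : MaxTuple R d} :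
    v ∈ filt R d n ↔ ∀ i, (v i : R) ∈ IsLocalRing.maximalIdeal R ^ n := Iff.rfl

theorem filt_antitone : Antitone (filt R d) := fun _ _ h _ hv i => Ideal.pow_le_pow_right h (hv i)

theorem mem_filt_one (v : MaxTuple R d) : v ∈ filt R d 1 := fun i => by
  rw [pow_one]; exact (v i).2

theorem bilin_mem_filt (F : FormalGroupLaw R d) {a b : ℕ} {v w : MaxTuple R d}
    (hv : v ∈ filt R d a) (hw : w ∈ filt R d b) : F.bilin v w ∈ filt R d (a + b) := by
  intro i
  simp only [FormalGroupLaw.bilin, LinearMap.mk₂_apply, Submodule.coe_sum, Submodule.coe_smul,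
    smul_eq_mul]
  refine Ideal.sum_mem _ fun j _ => Ideal.sum_mem _ fun k _ => ?_
  rw [pow_add, mul_assoc]
  exact Ideal.mul_mem_left _ _ (Ideal.mul_mem_mul (hv j) (hw k))

theorem bracket_mem_filt (F : FormalGroupLaw R d) {a b : ℕ} {v w : MaxTuple R d}
    (hv : v ∈ filt R d a) (hw : w ∈ filt R d b) : F.bracket v w ∈ filt R d (a + b) := by
  refine sub_mem (bilin_mem_filt F hv hw) ?_
  rw [add_comm]
  exact bilin_mem_filt F hw hv

theorem pow_smul_mem_filt {ϖ : R} (hϖ : ϖ ∈ IsLocalRing.maximalIdeal R) {n : ℕ} (m : ℕ)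
    {v : MaxTuple R d} (hv : v ∈ filt R d n) : ϖ ^ m • v ∈ filt R d (m + n) := fun i => by
  rw [pow_add]
  exact Ideal.mul_mem_mul (Ideal.pow_mem_pow hϖ m) (hv i)

theorem exists_smul_of_mem_filt {ϖ : R} (hϖ : IsLocalRing.maximalIdeal R = Ideal.span {ϖ})
    {n : ℕ} {v : MaxTuple R d} (hv : v ∈ filt R d (n + 1)) :
    ∃ w : MaxTuple R d, v = ϖ ^ n • w := by
  have h : ∀ i, ∃ y : IsLocalRing.maximalIdeal R, (v i : R) = ϖ ^ n * y := by
    intro i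
    have := hv i
    generalize (v i : R) = z at this ⊢
    rw [hϖ, Ideal.span_singleton_pow, Ideal.mem_span_singleton] at this
    obtain ⟨y, hy⟩ := this
    refine ⟨⟨ϖ * y, ?_⟩, by rw [hy, pow_succ, mul_assoc]⟩
    rw [hϖ]
    exact Ideal.mul_mem_right _ _ (Ideal.mem_span_singleton_self ϖ)
  choose y hy using h
  exact ⟨y, funext fun i => Subtype.ext (hy i)⟩

end Filt

/-! ### Multiplication in coordinates -/

namespace StandardStructure

variable {R : Type*} [CommRing R] [IsLocalRing R] [TopologicalSpace R] {d : ℕ}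
  {G : Type*} [Group G] [TopologicalSpace G] (Γ : StandardStructure R d G)

/-- The second order expansion of the multiplication in coordinates: every monomial not accounted
for has degree at least three and involves both factors. -/
theorem coord_mul_sub_bilin_mem (hR : IsAdic (IsLocalRing.maximalIdeal R)) {a b : ℕ} {g h : G}
    (hg : Γ.coord g ∈ filt R d a) (hh : Γ.coord h ∈ filt R d b) :
    Γ.coord (g * h) - Γ.coord g - Γ.coord h - Γ.law.bilin (Γ.coord g) (Γ.coord h) ∈
      filt R d (a + b + min a b) := by
  classical
  intro i
  set x : Fin d ⊕ Fin d → R :=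
    Sum.elim (fun j => (Γ.coord g j : R)) (fun j => (Γ.coord h j : R)) with hx
  set f : ((Fin d ⊕ Fin d) →₀ ℕ) → R := fun m =>
    MvPowerSeries.coeff m (Γ.law.series i) * m.prod (fun v e => x v ^ e) with hf
  have hsum : HasSum f (Γ.coord (g * h) i : R) := Γ.hasSum_mul g h i
  set q : Fin d × Fin d → (Fin d ⊕ Fin d) →₀ ℕ := fun jk =>
    Finsupp.single (Sum.inl jk.1) 1 + Finsupp.single (Sum.inr jk.2) 1 with hq
  have hql : ∀ jk v, q jk (Sum.inl v) = if v = jk.1 then 1 else 0 := by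
    intro jk v; simp [hq, Finsupp.single_apply, eq_comm]
  have hqr : ∀ jk v, q jk (Sum.inr v) = if v = jk.2 then 1 else 0 := by
    intro jk v; simp [hq, Finsupp.single_apply, eq_comm]
  have hqinj : Function.Injective q := by
    intro u v huv
    have h1 := DFunLike.congr_fun huv (Sum.inl u.1)
    have h2 := DFunLike.congr_fun huv (Sum.inr u.2)
    rw [hql, hql, if_pos rfl] at h1
    rw [hqr, hqr, if_pos rfl] at h2
    refine Prod.ext ?_ ?_
    · by_contra hne; rw [if_neg hne] at h1; exact one_ne_zero h1
    · by_contra hne; rw [if_neg hne] at h2; exact one_ne_zero h2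
  set Q : Finset ((Fin d ⊕ Fin d) →₀ ℕ) := Finset.univ.image q with hQ
  have hlr : Finsupp.single (Sum.inl i : Fin d ⊕ Fin d) 1 ≠ Finsupp.single (Sum.inr i) 1 := by
    intro he
    have := DFunLike.congr_fun he (Sum.inl i)
    simp at this
  have hlQ : Finsupp.single (Sum.inl i : Fin d ⊕ Fin d) 1 ∉ Q := by
    intro hm
    obtain ⟨jk, -, hjk⟩ := Finset.mem_image.1 hm
    have := DFunLike.congr_fun hjk (Sum.inr jk.2)
    rw [hqr] at this
    simp at this
  have hrQ : Finsupp.single (Sum.inr i : Fin d ⊕ Fin d) 1 ∉ Q := by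
    intro hm
    obtain ⟨jk, -, hjk⟩ := Finset.mem_image.1 hm
    have := DFunLike.congr_fun hjk (Sum.inl jk.1)
    rw [hql] at this
    simp at this
  have hprodq : ∀ j k (m' : (Fin d ⊕ Fin d) →₀ ℕ),
      (q (j, k) + m').prod (fun v e => x v ^ e) =
        (Γ.coord g j : R) * (Γ.coord h k : R) * m'.prod (fun v e => x v ^ e) := by
    intro j k m'
    rw [Finsupp.prod_add_index' (by simp) (by simp [pow_add]),
      Finsupp.prod_add_index' (by simp) (by simp [pow_add])]
    simp [hx]
  have hkey := sub_sum_mem_of_hasSum hR hsum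
    (insert (Finsupp.single (Sum.inl i) 1) (insert (Finsupp.single (Sum.inr i) 1) Q))
    (a + b + min a b) (by
      intro m hm
      simp only [Finset.mem_insert, not_or] at hm
      obtain ⟨h1, h2, h3⟩ := hm
      by_cases h0 : MvPowerSeries.coeff m (Γ.law.series i) = 0
      · simp [hf, h0]
      obtain ⟨j, k, m', rfl⟩ := Γ.law.exists_of_coeff_ne_zero i h0 h1 h2
      have hm' : m' ≠ 0 := by
        rintro rfl
        exact h3 (Finset.mem_image.2 ⟨(j, k), Finset.mem_univ _, by simp [hq]⟩)
      refine Ideal.mul_mem_left _ _ ?_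
      rw [hprodq j k m', pow_add, pow_add]
      refine Ideal.mul_mem_mul (Ideal.mul_mem_mul (hg j) (hh k)) ?_
      obtain ⟨v, hv⟩ := Finsupp.support_nonempty_iff.2 hm'
      refine Ideal.mem_of_dvd _ (Finset.dvd_prod_of_mem _ hv) ?_
      refine Ideal.mem_of_dvd _ (dvd_pow_self (x v) (Finsupp.mem_support_iff.1 hv)) ?_
      rcases v with v | v
      · exact Ideal.pow_le_pow_right (min_le_left a b) (hg v)
      · exact Ideal.pow_le_pow_right (min_le_right a b) (hh v))
  have hne : Finsupp.single (Sum.inl i : Fin d ⊕ Fin d) 1 ∉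
      insert (Finsupp.single (Sum.inr i) 1) Q := by
    simp only [Finset.mem_insert, not_or]
    exact ⟨hlr, hlQ⟩
  rw [Finset.sum_insert hne, Finset.sum_insert hrQ, hQ, Finset.sum_image hqinj.injOn] at hkey
  have e1 : f (Finsupp.single (Sum.inl i) 1) = Γ.coord g i := by
    simp only [hf, Γ.law.coeff_single_inl, one_mul]
    rw [Finsupp.prod_single_index (h := fun v e => x v ^ e) (pow_zero _), pow_one]
    rfl
  have e2 : f (Finsupp.single (Sum.inr i) 1) = Γ.coord h i := by
    simp only [hf, Γ.law.coeff_single_inr, one_mul]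
    rw [Finsupp.prod_single_index (h := fun v e => x v ^ e) (pow_zero _), pow_one]
    rfl
  have e3 : ∑ jk, f (q jk) = (Γ.law.bilin (Γ.coord g) (Γ.coord h) i : R) := by
    simp only [FormalGroupLaw.bilin, LinearMap.mk₂_apply, Submodule.coe_sum, Submodule.coe_smul,
      smul_eq_mul, Fintype.sum_prod_type]
    refine Finset.sum_congr rfl fun j _ => Finset.sum_congr rfl fun k _ => ?_
    have := hprodq j k 0
    simp only [add_zero, Finsupp.prod_zero_index, mul_one] at this
    simp only [hf, this]
    rw [mul_assoc]
    rfl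
  rw [e1, e2, e3] at hkey
  have : ((Γ.coord (g * h) - Γ.coord g - Γ.coord h -
      Γ.law.bilin (Γ.coord g) (Γ.coord h)) i : R) =
      (Γ.coord (g * h) i : R) - (Γ.coord g i + (Γ.coord h i +
        Γ.law.bilin (Γ.coord g) (Γ.coord h) i)) := by
    simp only [Pi.sub_apply, Submodule.coe_sub]
    ring
  rw [this]
  exact hkey

theorem coord_mul_sub_mem (hR : IsAdic (IsLocalRing.maximalIdeal R)) {a b : ℕ} {g h : G}
    (hg : Γ.coord g ∈ filt R d a) (hh : Γ.coord h ∈ filt R d b) :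
    Γ.coord (g * h) - Γ.coord g - Γ.coord h ∈ filt R d (a + b) := by
  have h1 := filt_antitone (Nat.le_add_right _ _) (Γ.coord_mul_sub_bilin_mem hR hg hh)
  simpa using add_mem h1 (bilin_mem_filt Γ.law hg hh)

/-- Congruence of coordinates is congruence modulo the elements with small coordinates, even though
inversion has not been expanded: the level of `k` is raised one step at a time. -/
theorem coord_mul_sub_left_mem_iff (hR : IsAdic (IsLocalRing.maximalIdeal R)) {n : ℕ} (g k : G) :
    Γ.coord (g * k) - Γ.coord g ∈ filt R d n ↔ Γ.coord k ∈ filt R d n := by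
  constructor
  · intro h
    suffices ∀ j ≤ n, Γ.coord k ∈ filt R d j from this n le_rfl
    intro j
    induction j with
    | zero => intro _ i; simp
    | succ j ih =>
      intro hj
      have h1 := Γ.coord_mul_sub_mem hR (mem_filt_one (Γ.coord g)) (ih (by omega))
      rw [add_comm 1 j] at h1
      simpa using sub_mem (filt_antitone hj h) h1
  · intro h
    have h1 := Γ.coord_mul_sub_mem hR (mem_filt_one (Γ.coord g)) h
    simpa using add_mem (filt_antitone (Nat.le_add_left n 1) h1) h

theorem coord_mul_sub_right_mem_iff (hR : IsAdic (IsLocalRing.maximalIdeal R)) {n : ℕ} (k g : G) :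
    Γ.coord (k * g) - Γ.coord g ∈ filt R d n ↔ Γ.coord k ∈ filt R d n := by
  constructor
  · intro h
    suffices ∀ j ≤ n, Γ.coord k ∈ filt R d j from this n le_rfl
    intro j
    induction j with
    | zero => intro _ i; simp
    | succ j ih =>
      intro hj
      have h1 := Γ.coord_mul_sub_mem hR (ih (by omega)) (mem_filt_one (Γ.coord g))
      have h2 := sub_mem (filt_antitone hj h) h1
      convert h2 using 1
      abel
  · intro h
    have h1 := Γ.coord_mul_sub_mem hR h (mem_filt_one (Γ.coord g))
    have h2 := add_mem (filt_antitone (Nat.le_add_right n 1) h1) h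
    convert h2 using 1
    abel

theorem coord_one_mem (hR : IsAdic (IsLocalRing.maximalIdeal R)) (n : ℕ) :
    Γ.coord 1 ∈ filt R d n := by
  rw [← Γ.coord_mul_sub_left_mem_iff hR 1 1, mul_one, sub_self]
  exact zero_mem _

/-! ### Congruence subgroups and commutators -/

/-- The congruence subgroup of the elements of `G` with coordinates in `𝓜 ^ n`. As all coordinates
lie in `𝓜`, it is `G` itself for `n ≤ 1`. -/
def level (hR : IsAdic (IsLocalRing.maximalIdeal R)) (n : ℕ) : Subgroup G where
  carrier := {g | Γ.coord g ∈ filt R d n}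
  mul_mem' {g h} hg hh := by
    simpa using add_mem ((Γ.coord_mul_sub_left_mem_iff hR g h).2 hh) hg
  one_mem' := Γ.coord_one_mem hR n
  inv_mem' {g} hg := by
    refine (Γ.coord_mul_sub_left_mem_iff hR g g⁻¹).1 ?_
    rw [mul_inv_cancel]
    exact sub_mem (Γ.coord_one_mem hR n) hg

theorem mem_level (hR : IsAdic (IsLocalRing.maximalIdeal R)) {n : ℕ} {g : G} :
    g ∈ Γ.level hR n ↔ Γ.coord g ∈ filt R d n := Iff.rfl

theorem inv_mul_mem_level_iff (hR : IsAdic (IsLocalRing.maximalIdeal R))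
    {n : ℕ} {g h : G} :
    g⁻¹ * h ∈ Γ.level hR n ↔ Γ.coord h - Γ.coord g ∈ filt R d n := by
  rw [mem_level, ← Γ.coord_mul_sub_left_mem_iff hR g, mul_inv_cancel_left]

theorem coord_commutator_mem (hR : IsAdic (IsLocalRing.maximalIdeal R)) {a b : ℕ} {g h : G}
    (hg : Γ.coord g ∈ filt R d a) (hh : Γ.coord h ∈ filt R d b) :
    Γ.coord (g * h * g⁻¹ * h⁻¹) ∈ filt R d (a + b) := by
  rw [← Γ.coord_mul_sub_right_mem_iff hR _ (h * g)]
  have h1 := Γ.coord_mul_sub_mem hR hg hh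
  have h2 := Γ.coord_mul_sub_mem hR hh hg
  rw [add_comm b a] at h2
  have h3 := sub_mem h1 h2
  rw [show g * h * g⁻¹ * h⁻¹ * (h * g) = g * h by group]
  convert h3 using 1
  abel

/-- To leading order, commutators in the group are brackets in its Lie ring. -/
theorem coord_commutator_sub_bracket_mem (hR : IsAdic (IsLocalRing.maximalIdeal R))
    {a b : ℕ} {g h : G}
    (hg : Γ.coord g ∈ filt R d a) (hh : Γ.coord h ∈ filt R d b) :
    Γ.coord (g * h * g⁻¹ * h⁻¹) - Γ.law.bracket (Γ.coord g) (Γ.coord h) ∈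
      filt R d (a + b + min a b) := by
  have h1 := Γ.coord_mul_sub_bilin_mem hR hg hh
  have h2 := Γ.coord_mul_sub_bilin_mem hR hh hg
  rw [add_comm b a, min_comm b a] at h2
  have h3 := Γ.coord_commutator_mem hR hg hh
  have h4 : Γ.coord (h * g) ∈ filt R d (min a b) :=
    (Γ.level hR _).mul_mem (filt_antitone (min_le_right a b) hh)
      (filt_antitone (min_le_left a b) hg)
  have h5 := Γ.coord_mul_sub_mem hR h3 h4
  rw [show g * h * g⁻¹ * h⁻¹ * (h * g) = g * h by group] at h5
  have h6 := sub_mem (sub_mem h1 h2) h5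
  rw [FormalGroupLaw.bracket, LinearMap.sub_apply, LinearMap.sub_apply, LinearMap.flip_apply]
  convert h6 using 1
  abel

instance level_normal (hR : IsAdic (IsLocalRing.maximalIdeal R)) (n : ℕ) :
    (Γ.level hR n).Normal where
  conj_mem h hh g := by
    have : g * h * g⁻¹ = (g * h * g⁻¹ * h⁻¹) * h := by group
    rw [this]
    exact mul_mem (filt_antitone (Nat.le_add_left n 1)
      (Γ.coord_commutator_mem hR (mem_filt_one _) hh)) hh

/-- The multiplication is the addition of coordinates to first order. -/
theorem coord_prod_sub_sum_mem (hR : IsAdic (IsLocalRing.maximalIdeal R)) {m k : ℕ}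
    (c : Fin k → G) (hc : ∀ j, Γ.coord (c j) ∈ filt R d m) :
    Γ.coord (List.ofFn c).prod - ∑ j, Γ.coord (c j) ∈ filt R d (m + m) := by
  induction k with
  | zero => simpa using Γ.coord_one_mem hR (m + m)
  | succ k ih =>
    rw [List.ofFn_succ, List.prod_cons, Fin.sum_univ_succ]
    have h1 : (List.ofFn fun i : Fin k => c i.succ).prod ∈ Γ.level hR m :=
      list_prod_mem (by
        intro x hx
        obtain ⟨j, rfl⟩ := (List.mem_ofFn' _ _).1 hx
        exact hc _)
    have h2 := add_mem (Γ.coord_mul_sub_mem hR (hc 0) h1) (ih (fun j => c j.succ) fun j => hc _)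
    convert h2 using 1
    abel

theorem isOpen_level (hR : IsAdic (IsLocalRing.maximalIdeal R)) (n : ℕ) :
    IsOpen (Γ.level hR n : Set G) := by
  have hI : IsOpen ((IsLocalRing.maximalIdeal R ^ n : Ideal R) : Set R) := by
    rw [isOpen_iff_mem_nhds]
    intro x hx
    refine (hR.hasBasis_nhds x).mem_of_superset (i := n) trivial ?_
    rintro _ ⟨y, hy, rfl⟩
    exact add_mem hx hy
  have : (Γ.level hR n : Set G) =
      ⋂ i, (fun g => (Γ.coord g i : R)) ⁻¹' (IsLocalRing.maximalIdeal R ^ n : Ideal R) := by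
    ext g
    simp only [SetLike.mem_coe, mem_level, mem_filt, Set.mem_iInter, Set.mem_preimage]
  rw [this]
  refine isOpen_iInter_of_finite fun i => hI.preimage ?_
  exact continuous_subtype_val.comp ((continuous_apply i).comp Γ.coord.continuous)

end StandardStructure

/-! ### Perfect Lie algebras -/

section Perfect

variable {R : Type*} [CommRing R] [IsLocalRing R] {d : ℕ}

/-- If `𝓛_G` is perfect, some multiple of every vector of `L(G)` lies in a submodule containing
all brackets. -/
theorem FormalGroupLaw.LiePerfect.exists_smul_mem {F : FormalGroupLaw R d} (hF : F.LiePerfect)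
    {W : Submodule R (MaxTuple R d)} (hW : ∀ x y, F.bracket x y ∈ W) (v : MaxTuple R d) :
    ∃ r ∈ nonZeroDivisors R, r • v ∈ W := by
  -- the quotient map by `W` kills all brackets, hence vanishes after extension of scalars
  set φ : (FractionRing R ⊗[R] MaxTuple R d) →ₗ[FractionRing R]
      (FractionRing R ⊗[R] (MaxTuple R d ⧸ W)) := W.mkQ.baseChange (FractionRing R) with hφ
  have hbr : ∀ x y, φ (F.lieAlgBracket x y) = 0 := by
    intro x y
    induction x with
    | zero => simp
    | add x x' h h' => simp [h, h']
    | tmul a x =>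
      induction y with
      | zero => simp
      | add y y' h h' => simp [h, h']
      | tmul b y =>
        rw [FormalGroupLaw.lieAlgBracket, LinearMap.BilinMap.baseChange_tmul, hφ,
          LinearMap.baseChange_tmul, Submodule.mkQ_apply,
          (Submodule.Quotient.mk_eq_zero W).2 (hW x y), TensorProduct.tmul_zero]
  have hker : φ = 0 := by
    rw [← LinearMap.ker_eq_top, eq_top_iff, ← hF, Submodule.span_le]
    rintro _ ⟨x, y, rfl⟩
    exact hbr x y
  have h0 : (TensorProduct.mk R (FractionRing R) (MaxTuple R d ⧸ W) 1) (W.mkQ v) = 0 := by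
    have := LinearMap.congr_fun hker ((1 : FractionRing R) ⊗ₜ[R] v)
    simpa [hφ] using this
  rw [IsLocalizedModule.eq_zero_iff (nonZeroDivisors R)] at h0
  obtain ⟨r, hr⟩ := h0
  refine ⟨r, r.2, ?_⟩
  rw [← Submodule.Quotient.mk_eq_zero, Submodule.Quotient.mk_smul]
  exact hr

end Perfect

section DVR

variable {R : Type*} [CommRing R] [IsDomain R] [IsDiscreteValuationRing R] {d : ℕ}

theorem nonempty_basis_maxTuple (R : Type*) [CommRing R] [IsDomain R] [IsDiscreteValuationRing R]
    (d : ℕ) : Nonempty (Module.Basis (Fin d) R (MaxTuple R d)) := by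
  obtain ⟨ϖ, hϖ⟩ := IsDiscreteValuationRing.exists_irreducible R
  have h := hϖ.maximalIdeal_eq
  have e : R ≃ₗ[R] IsLocalRing.maximalIdeal R :=
    (LinearEquiv.toSpanNonzeroSingleton R R ϖ hϖ.ne_zero).trans (LinearEquiv.ofEq _ _ h.symm)
  exact ⟨Module.Basis.ofEquivFun (LinearEquiv.piCongrRight fun _ => e.symm)⟩

/-- Effective form of perfectness: `ϖ ^ s L(G)` is contained in the set of the sums
`∑ j, (e j, w j)`, where `e` is a basis of `L(G)`. -/
theorem FormalGroupLaw.LiePerfect.exists_pow_smul_eq_sum {F : FormalGroupLaw R d}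
    (hF : F.LiePerfect) {ϖ : R} (hϖ : Irreducible ϖ)
    (e : Module.Basis (Fin d) R (MaxTuple R d)) :
    ∃ s : ℕ, ∀ v : MaxTuple R d, ∃ w : Fin d → MaxTuple R d,
      ϖ ^ s • v = ∑ j, F.bracket (e j) (w j) := by
  set Φ : (Fin d → MaxTuple R d) →ₗ[R] MaxTuple R d :=
    ∑ j, (F.bracket (e j)).comp (LinearMap.proj j) with hΦ
  have hΦa : ∀ w, Φ w = ∑ j, F.bracket (e j) (w j) := by
    intro w; simp [hΦ]
  have hW : ∀ x y, F.bracket x y ∈ LinearMap.range Φ := by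
    intro x y
    refine ⟨fun j => e.repr x j • y, ?_⟩
    rw [hΦa]
    conv_rhs => rw [← e.sum_repr x]
    rw [map_sum, LinearMap.sum_apply]
    simp only [map_smul, LinearMap.smul_apply]
  have hpow : ∀ v : MaxTuple R d, ∃ s : ℕ, ϖ ^ s • v ∈ LinearMap.range Φ := by
    intro v
    obtain ⟨r, hr, hrv⟩ := hF.exists_smul_mem hW v
    obtain ⟨s, u, hu⟩ := IsDiscreteValuationRing.eq_unit_mul_pow_irreducible
      (nonZeroDivisors.ne_zero hr) hϖ
    refine ⟨s, ?_⟩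
    have : ϖ ^ s • v = (↑u⁻¹ : R) • r • v := by
      rw [hu, smul_smul, ← mul_assoc, Units.inv_mul, one_mul]
    rw [this]
    exact Submodule.smul_mem _ _ hrv
  choose s hs using fun j => hpow (e j)
  refine ⟨∑ j, s j, fun v => ?_⟩
  suffices h : ϖ ^ (∑ j, s j) • v ∈ LinearMap.range Φ by
    obtain ⟨w, hw⟩ := h
    exact ⟨w, by rw [← hw, hΦa]⟩
  rw [← e.sum_repr v, Finset.smul_sum]
  refine Submodule.sum_mem _ fun j _ => ?_
  rw [smul_comm]
  refine Submodule.smul_mem _ _ ?_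
  rw [← Finset.sum_erase_add _ _ (Finset.mem_univ j), pow_add, mul_smul]
  exact Submodule.smul_mem _ _ (hs j)

end DVR

/-! ### Growth of covering lengths -/

/-- A sequence of scales at which a length multiplied by `K` pays for a fourth more precision has
polynomial growth, with an exponent depending only on `K`. -/
theorem exists_le_mul_rpow_of_step {P : ℕ → ℕ → Prop} {K n₀ L : ℕ} (hK : 1 ≤ K)
    (hmono : ∀ ℓ n m, m ≤ n → P ℓ n → P ℓ m)
    (hstep : ∀ ℓ n, n₀ ≤ n → P ℓ n → P (K * ℓ) (n + n / 4))
    (hbase : P L (2 * n₀ + 100)) {n : ℕ} (hn : 1 ≤ n) :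
    ∃ ℓ, P ℓ n ∧ (ℓ : ℝ) ≤ L * (n : ℝ) ^ (Real.log K / Real.log (7 / 6)) := by
  set γ : ℝ := Real.log K / Real.log (7 / 6) with hγ
  have hlog : 0 < Real.log (7 / 6 : ℝ) := Real.log_pos (by norm_num)
  have hK' : (1 : ℝ) ≤ K := by exact_mod_cast hK
  have hγ0 : 0 ≤ γ := div_nonneg (Real.log_nonneg hK') hlog.le
  have hγK : ((7 / 6 : ℝ)) ^ γ = K := by
    rw [Real.rpow_def_of_pos (by norm_num), hγ, mul_div_cancel₀ _ hlog.ne',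
      Real.exp_log (by linarith)]
  induction n using Nat.strong_induction_on with
  | _ n ih =>
    by_cases h : n ≤ 2 * n₀ + 100
    · refine ⟨L, hmono _ _ _ h hbase, ?_⟩
      have : (1 : ℝ) ≤ (n : ℝ) ^ γ := Real.one_le_rpow (by exact_mod_cast hn) hγ0
      nlinarith [Nat.cast_nonneg (α := ℝ) L]
    -- `m = n - n / 6` satisfies both `n ≤ m + m / 4` and `m ≤ 6 * n / 7`, as `n` is large
    · obtain ⟨ℓ, hℓ, hle⟩ := ih (n - n / 6) (by omega) (by omega)
      refine ⟨K * ℓ, hmono _ _ _ (by omega) (hstep ℓ _ (by omega) hℓ), ?_⟩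
      have h1 : (7 / 6 : ℝ) * ((n - n / 6 : ℕ) : ℝ) ≤ n := by
        have : 7 * (n - n / 6) ≤ 6 * n := by omega
        have : (7 : ℝ) * ((n - n / 6 : ℕ) : ℝ) ≤ 6 * n := by exact_mod_cast this
        linarith
      have h2 := Real.rpow_le_rpow (by positivity) h1 hγ0
      rw [Real.mul_rpow (by norm_num) (by positivity), hγK] at h2
      push_cast
      calc (K : ℝ) * ℓ ≤ K * (L * ((n - n / 6 : ℕ) : ℝ) ^ γ) := by gcongr
        _ = L * (K * ((n - n / 6 : ℕ) : ℝ) ^ γ) := by ring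
        _ ≤ L * (n : ℝ) ^ γ := by gcongr

/-! ### Products of commutators as approximations -/

theorem ofFn_prod_mem_pow {M : Type*} [Monoid M] {A : Set M} {k : ℕ} {c : Fin k → M}
    (hc : ∀ j, c j ∈ A) : (List.ofFn c).prod ∈ A ^ k :=
  Set.mem_pow.2 ⟨fun j => ⟨c j, hc j⟩, rfl⟩

theorem inv_mem_pow {G : Type*} [Group G] {T : Set G} (hT : T⁻¹ = T) {ℓ : ℕ} {x : G}
    (hx : x ∈ T ^ ℓ) : x⁻¹ ∈ T ^ ℓ := by
  have : x⁻¹ ∈ (T ^ ℓ)⁻¹ := Set.inv_mem_inv.2 hx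
  rwa [← inv_pow, hT] at this

namespace StandardStructure

variable {R : Type*} [CommRing R] {d : ℕ} {G : Type*} [Group G] [TopologicalSpace G]

/-- The products of `ℓ` elements of `T` represent all the elements of `G` modulo `𝓜 ^ n`. -/
def Covers [IsLocalRing R] [TopologicalSpace R] (Γ : StandardStructure R d G) (T : Set G)
    (ℓ n : ℕ) : Prop :=
  ∀ g : G, ∃ t ∈ T ^ ℓ, Γ.coord g - Γ.coord t ∈ filt R d n

variable [IsDomain R] [IsDiscreteValuationRing R] [TopologicalSpace R]
  (Γ : StandardStructure R d G)

/-- The Solovay–Kitaev step: an element close to `1` is, to a higher precision, a product of `d`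
commutators, and these are insensitive to small errors in their entries. -/
theorem exists_covers_step (hR : IsAdic (IsLocalRing.maximalIdeal R)) (hF : Γ.law.LiePerfect) :
    ∃ n₀ : ℕ, ∀ T : Set G, T⁻¹ = T → ∀ ℓ n, n₀ ≤ n → Γ.Covers T ℓ n →
      Γ.Covers T ((4 * d + 1) * ℓ) (n + n / 4) := by
  obtain ⟨ϖ, hϖ⟩ := IsDiscreteValuationRing.exists_irreducible R
  obtain ⟨e⟩ := nonempty_basis_maxTuple R d
  obtain ⟨s, hs⟩ := hF.exists_pow_smul_eq_sum hϖ e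
  have hϖm : ϖ ∈ IsLocalRing.maximalIdeal R := by
    rw [hϖ.maximalIdeal_eq]; exact Ideal.mem_span_singleton_self ϖ
  -- `n ≥ 6 * s + 10` makes the precision `n + n / 2 - O(s)` of one step at least `n + n / 4`
  refine ⟨6 * s + 10, fun T hT ℓ n hn hcov g => ?_⟩
  obtain ⟨t, ht, htg⟩ := hcov g
  rw [← Γ.inv_mul_mem_level_iff hR, mem_level] at htg
  obtain ⟨n', rfl⟩ : ∃ n', n = n' + 1 := ⟨n - 1, by omega⟩
  obtain ⟨α, β, hαβ, hle, hge⟩ : ∃ α β, n' = α + β + s ∧ α ≤ β ∧ β ≤ α + 1 :=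
    ⟨(n' - s) / 2, n' - s - (n' - s) / 2, by omega, by omega, by omega⟩
  obtain ⟨v, hv⟩ := exists_smul_of_mem_filt hϖ.maximalIdeal_eq htg
  obtain ⟨w, hw⟩ := hs v
  have hsum : Γ.coord (t⁻¹ * g) = ∑ j, Γ.law.bracket (ϖ ^ α • e j) (ϖ ^ β • w j) := by
    rw [hv, hαβ, pow_add, mul_smul, hw, Finset.smul_sum]
    refine Finset.sum_congr rfl fun j _ => ?_
    rw [map_smul, map_smul, LinearMap.smul_apply, smul_smul, pow_add, mul_comm]
  have hu : ∀ j, ϖ ^ α • e j ∈ filt R d (α + 1) := fun j =>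
    pow_smul_mem_filt hϖm α (mem_filt_one _)
  have hw' : ∀ j, ϖ ^ β • w j ∈ filt R d (β + 1) := fun j =>
    pow_smul_mem_filt hϖm β (mem_filt_one _)
  -- the entries of the brackets are replaced by products of `ℓ` elements of `T`
  choose x hxT hx using fun j => hcov (Γ.coord.symm (ϖ ^ α • e j))
  choose y hyT hy using fun j => hcov (Γ.coord.symm (ϖ ^ β • w j))
  simp only [Homeomorph.apply_symm_apply] at hx hy
  have hxf : ∀ j, Γ.coord (x j) ∈ filt R d (α + 1) := fun j => by
    simpa using sub_mem (hu j) (filt_antitone (show α + 1 ≤ n' + 1 by omega) (hx j))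
  have hyf : ∀ j, Γ.coord (y j) ∈ filt R d (β + 1) := fun j => by
    simpa using sub_mem (hw' j) (filt_antitone (show β + 1 ≤ n' + 1 by omega) (hy j))
  set c : Fin d → G := fun j => x j * y j * (x j)⁻¹ * (y j)⁻¹ with hc
  set m := n' + 1 + (n' + 1) / 4 with hm
  -- the error has three parts: two from approximating the entries, of level at least
  -- `n' + α + 2`, and one from exchanging bracket and commutator
  have hcj : ∀ j, Γ.law.bracket (ϖ ^ α • e j) (ϖ ^ β • w j) - Γ.coord (c j) ∈ filt R d m := by
    intro j
    have h1 := filt_antitone (show m ≤ _ by omega)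
      (Γ.coord_commutator_sub_bracket_mem hR (hxf j) (hyf j))
    have h2 := filt_antitone (show m ≤ _ by omega) (bracket_mem_filt Γ.law (hx j) (hw' j))
    have h3 := filt_antitone (show m ≤ _ by omega) (bracket_mem_filt Γ.law (hxf j) (hy j))
    have h4 := sub_mem (add_mem h2 h3) h1
    convert h4 using 1
    rw [map_sub, map_sub, LinearMap.sub_apply]
    abel
  have hcf : ∀ j, Γ.coord (c j) ∈ filt R d (α + 1 + (β + 1)) := fun j =>
    Γ.coord_commutator_mem hR (hxf j) (hyf j)
  have hprod : Γ.coord (t⁻¹ * g) - Γ.coord (List.ofFn c).prod ∈ filt R d m := by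
    have h1 := filt_antitone (show m ≤ _ by omega) (Γ.coord_prod_sub_sum_mem hR c hcf)
    have h2 := sub_mem (Submodule.sum_mem _ fun j (_ : j ∈ Finset.univ) => hcj j) h1
    rw [hsum]
    convert h2 using 1
    rw [Finset.sum_sub_distrib]
    abel
  refine ⟨t * (List.ofFn c).prod, ?_, ?_⟩
  -- `ℓ` factors for `t`, and `4 * ℓ` for each commutator, by symmetry of `T`
  · rw [show (4 * d + 1) * ℓ = ℓ + (ℓ + ℓ + ℓ + ℓ) * d by ring, pow_add, pow_mul]
    refine Set.mul_mem_mul ht (ofFn_prod_mem_pow fun j => ?_)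
    rw [pow_add, pow_add, pow_add]
    exact Set.mul_mem_mul (Set.mul_mem_mul (Set.mul_mem_mul (hxT j) (hyT j))
      (inv_mem_pow hT (hxT j))) (inv_mem_pow hT (hyT j))
  · rw [← Γ.inv_mul_mem_level_iff hR] at hprod ⊢
    simpa [mul_assoc] using hprod

end StandardStructure

/-! ### Generation of finite quotients -/

/-- In a finite group, a single exponent works for all symmetric generating sets containing `1`. -/
theorem exists_forall_mem_pow (Q : Type*) [Group Q] [Finite Q] :
    ∃ L : ℕ, 1 ≤ L ∧ ∀ A : Set Q, A⁻¹ = A → (1 : Q) ∈ A → Subgroup.closure A = ⊤ →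
      ∀ x, x ∈ A ^ L := by
  classical
  have h : ∀ (A : Set Q) (x : Q), ∃ k, A⁻¹ = A → Subgroup.closure A = ⊤ → x ∈ A ^ k := by
    intro A x
    by_cases hA : A⁻¹ = A ∧ Subgroup.closure A = ⊤
    · have hx : x ∈ Subgroup.closure A := by rw [hA.2]; trivial
      suffices ∃ k, x ∈ A ^ k by
        obtain ⟨k, hk⟩ := this
        exact ⟨k, fun _ _ => hk⟩
      induction hx using Subgroup.closure_induction with
      | mem x hx => exact ⟨1, by simpa using hx⟩
      | one => exact ⟨0, by simp⟩
      | mul x y _ _ hx hy =>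
        obtain ⟨k, hk⟩ := hx
        obtain ⟨l, hl⟩ := hy
        exact ⟨k + l, by rw [pow_add]; exact Set.mul_mem_mul hk hl⟩
      | inv x _ hx =>
        obtain ⟨k, hk⟩ := hx
        exact ⟨k, inv_mem_pow hA.1 hk⟩
    · exact ⟨0, fun h1 h2 => absurd ⟨h1, h2⟩ hA⟩
  choose k hk using h
  obtain ⟨L, hL⟩ := (Set.finite_range (Function.uncurry k)).bddAbove
  refine ⟨L + 1, by omega, fun A hA h1 hgen x => ?_⟩
  have hle : k A x ≤ L := hL ⟨(A, x), rfl⟩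
  exact Set.pow_subset_pow_right h1 (by omega) (hk A x hA hgen)

/-- The products of two generators generate every quotient of a group by an open normal subgroup,
unless the generators avoid a subgroup of index two. -/
theorem closure_image_mul_self_eq_top {G : Type*} [Group G] [TopologicalSpace G]
    [IsTopologicalGroup G] {S : Set G} (hne : S.Nonempty) (hS : ∀ s ∈ S, s⁻¹ ∈ S)
    (hdense : Dense (Subgroup.closure S : Set G)) (N : Subgroup G) [N.Normal]
    (hN : IsOpen (N : Set G))
    (hpar : ∀ H : Subgroup G, N ≤ H → H.index = 2 → ∃ s ∈ S, s ∈ H) :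
    Subgroup.closure (QuotientGroup.mk' N '' (S * S)) = ⊤ := by
  obtain ⟨s₀, hs₀⟩ := hne
  set H : Subgroup G := (Subgroup.closure (QuotientGroup.mk' N '' (S * S))).comap
    (QuotientGroup.mk' N) with hH
  have hNH : N ≤ H := by
    intro x hx
    have : QuotientGroup.mk' N x = 1 := (QuotientGroup.eq_one_iff x).2 hx
    rw [hH, Subgroup.mem_comap, this]
    exact one_mem _
  have hSS : ∀ s ∈ S, ∀ t ∈ S, s * t ∈ H := fun s hs t ht =>
    Subgroup.subset_closure ⟨_, Set.mul_mem_mul hs ht, rfl⟩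
  have hgen : ∀ g : G, ∃ x ∈ Subgroup.closure S, x⁻¹ * g ∈ N := by
    intro g
    have hopen : IsOpen ((fun x => x⁻¹ * g) ⁻¹' (N : Set G)) :=
      hN.preimage (continuous_inv.mul continuous_const)
    obtain ⟨x, hx1, hx2⟩ := hdense.inter_open_nonempty _ hopen ⟨g, by simp⟩
    exact ⟨x, hx2, hx1⟩
  have htop : ∀ H' : Subgroup G, N ≤ H' → S ⊆ H' → H' = ⊤ := by
    intro H' h1 h2
    rw [eq_top_iff]
    intro g _
    obtain ⟨x, hx, hxg⟩ := hgen g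
    have h3 := H'.mul_mem ((Subgroup.closure_le H').2 h2 hx) (h1 hxg)
    simpa using h3
  suffices hHtop : H = ⊤ by
    rw [eq_top_iff]
    intro x _
    obtain ⟨g, rfl⟩ := QuotientGroup.mk'_surjective N x
    have : g ∈ H := by rw [hHtop]; trivial
    exact this
  by_cases hex : ∃ s ∈ S, s ∈ H
  · obtain ⟨s, hs, hsH⟩ := hex
    exact htop H hNH fun t ht => by
      simpa using H.mul_mem (H.inv_mem hsH) (hSS s hs t ht)
  · exfalso
    refine hex (hpar H hNH ?_)
    -- the subgroup generated by `S` is contained in the union of `H` and `H * s₀⁻¹`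
    have hcl : ∀ x ∈ Subgroup.closure S, x ∈ H ∨ x * s₀ ∈ H := by
      intro x hx
      have hgood : ∀ x, (x ∈ H ∨ x * s₀ ∈ H) → ∀ y ∈ S, (x * y ∈ H ∨ x * y * s₀ ∈ H) := by
        intro x h y hy
        rcases h with h | h
        · right
          rw [mul_assoc]
          exact H.mul_mem h (hSS y hy s₀ hs₀)
        · left
          have := H.mul_mem h (hSS s₀⁻¹ (hS _ hs₀) y hy)
          simpa [mul_assoc] using this
      induction hx using Subgroup.closure_induction_right with
      | one => exact Or.inl H.one_mem
      | mul_right x _ y hy h => exact hgood x h y hy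
      | mul_inv_cancel x _ y hy h => exact hgood x h y⁻¹ (hS y hy)
    rw [Subgroup.index_eq_two_iff]
    refine ⟨s₀, fun g => ?_⟩
    have hor : g ∈ H ∨ g * s₀ ∈ H := by
      obtain ⟨x, hx, hxg⟩ := hgen g
      rcases hcl x hx with h | h
      · left
        simpa using H.mul_mem h (hNH hxg)
      · right
        have h1 : s₀⁻¹ * (x⁻¹ * g) * s₀ ∈ N := by
          simpa using Subgroup.Normal.conj_mem ‹N.Normal› _ hxg s₀⁻¹
        have := H.mul_mem h (hNH h1)
        simpa [mul_assoc] using this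
    rcases hor with h | h
    · refine Or.inr ⟨h, fun h' => hex ⟨s₀, hs₀, ?_⟩⟩
      simpa using H.mul_mem (H.inv_mem h) h'
    · refine Or.inl ⟨h, fun h' => hex ⟨s₀, hs₀, ?_⟩⟩
      simpa using H.mul_mem (H.inv_mem h') h

/-! ### Contraction by averages in orthogonal representations -/

section Contraction

variable {Q E ι : Type*} [Group Q] [NormedAddCommGroup E] [InnerProductSpace ℝ E] [Fintype ι]

/-- The average of the operators `U (σ s)`, for an orthogonal representation `U`. -/
noncomputable def avgOp (U : Q →* (E ≃ₗᵢ[ℝ] E)) (σ : ι → Q) : E →ₗ[ℝ] E :=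
  (Fintype.card ι : ℝ)⁻¹ • ∑ s, (U (σ s)).toLinearEquiv.toLinearMap

theorem avgOp_apply (U : Q →* (E ≃ₗᵢ[ℝ] E)) (σ : ι → Q) (f : E) :
    avgOp U σ f = (Fintype.card ι : ℝ)⁻¹ • ∑ s, U (σ s) f := by
  simp [avgOp]

theorem sum_avgOp_eq_zero [Fintype Q] (U : Q →* (E ≃ₗᵢ[ℝ] E)) (σ : ι → Q) {f : E}
    (hf : ∑ g, U g f = 0) : ∑ g, U g (avgOp U σ f) = 0 := by
  simp only [avgOp_apply, map_smul, map_sum, ← Finset.smul_sum]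
  rw [Finset.sum_comm]
  refine smul_eq_zero_of_right _ (Finset.sum_eq_zero fun s _ => ?_)
  rw [← hf, ← Equiv.sum_comp (Equiv.mulRight (σ s)) fun g => U g f]
  simp

theorem rep_mul_apply (U : Q →* (E ≃ₗᵢ[ℝ] E)) (g h : Q) (f : E) :
    U (g * h) f = U g (U h f) := by
  rw [map_mul]; rfl

theorem norm_sub_mul_le (U : Q →* (E ≃ₗᵢ[ℝ] E)) (f : E) (g h : Q) :
    ‖f - U (g * h) f‖ ≤ ‖f - U g f‖ + ‖f - U h f‖ := by
  have : ‖f - U h f‖ = ‖U g f - U (g * h) f‖ := by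
    rw [rep_mul_apply, ← map_sub, LinearIsometryEquiv.norm_map]
  rw [this]
  exact norm_sub_le_norm_sub_add_norm_sub _ _ _

theorem norm_sub_le_of_mem_pow (U : Q →* (E ≃ₗᵢ[ℝ] E)) (f : E) {A : Set Q} {b : ℝ}
    (hA : ∀ g ∈ A, ‖f - U g f‖ ≤ b) {D : ℕ} {g : Q} (hg : g ∈ A ^ D) :
    ‖f - U g f‖ ≤ D * b := by
  induction D generalizing g with
  | zero =>
    rw [pow_zero, Set.mem_one] at hg
    simp [hg]
  | succ D ih =>
    rw [pow_succ] at hg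
    obtain ⟨x, hx, y, hy, rfl⟩ := hg
    have := norm_sub_mul_le U f x y
    push_cast
    linarith [ih hx, hA y hy]

/-- A vector orthogonal to the invariants is moved by some element of the group at least as much as
an orthogonal vector; it is thus moved by one of the `(σ s)⁻¹ * σ t`, which makes the average of
the `U (σ s) f` shorter than `f`. -/
theorem norm_avgOp_sq_le [Fintype Q] [Nonempty ι] (U : Q →* (E ≃ₗᵢ[ℝ] E)) (σ : ι → Q) {D : ℕ}
    (hD : 1 ≤ D) (hgen : ∀ g : Q, g ∈ {x | ∃ s t, (σ s)⁻¹ * σ t = x} ^ D) {f : E}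
    (hf : ∑ g, U g f = 0) :
    ‖avgOp U σ f‖ ^ 2 ≤ (1 - 1 / ((Fintype.card ι : ℝ) ^ 2 * (D : ℝ) ^ 2)) * ‖f‖ ^ 2 := by
  set n : ℝ := (Fintype.card ι : ℝ) with hn
  have hn0 : 0 < n := by rw [hn]; exact_mod_cast Fintype.card_pos
  have hD0 : (0 : ℝ) < D := by exact_mod_cast hD
  set Δ : ℝ := ∑ s, ∑ t, ‖U (σ s) f - U (σ t) f‖ ^ 2 with hΔ
  have hdiff : ∀ s t, ‖f - U ((σ s)⁻¹ * σ t) f‖ = ‖U (σ s) f - U (σ t) f‖ := by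
    intro s t
    rw [← LinearIsometryEquiv.norm_map (U (σ s)), map_sub, ← rep_mul_apply,
      mul_inv_cancel_left]
  -- the averages of `U g f` over the group vanish, so that `f` is moved far on average
  have hfar : ∃ g : Q, 2 * ‖f‖ ^ 2 ≤ ‖f - U g f‖ ^ 2 := by
    by_contra! hc
    have h1 : ∑ g : Q, ‖f - U g f‖ ^ 2 < ∑ _g : Q, 2 * ‖f‖ ^ 2 :=
      Finset.sum_lt_sum_of_nonempty Finset.univ_nonempty fun g _ => hc g
    have h2 : ∑ g : Q, ‖f - U g f‖ ^ 2 = ∑ _g : Q, 2 * ‖f‖ ^ 2 := by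
      have h3 : ∀ g : Q, ‖f - U g f‖ ^ 2 = 2 * ‖f‖ ^ 2 - 2 * inner ℝ f (U g f) := by
        intro g
        rw [norm_sub_sq_real, LinearIsometryEquiv.norm_map]
        ring
      simp only [h3]
      rw [Finset.sum_sub_distrib, ← Finset.mul_sum (f := fun g => inner ℝ f (U g f)), ← inner_sum,
        hf, inner_zero_right, mul_zero, sub_zero]
    linarith
  have hΔle : 2 * ‖f‖ ^ 2 ≤ (D : ℝ) ^ 2 * Δ := by
    obtain ⟨g, hg⟩ := hfar
    have hb : ‖f - U g f‖ ≤ D * Real.sqrt Δ := by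
      refine norm_sub_le_of_mem_pow U f ?_ (hgen g)
      rintro _ ⟨s, t, rfl⟩
      rw [hdiff]
      refine Real.le_sqrt_of_sq_le ?_
      refine le_trans ?_ (Finset.single_le_sum
        (f := fun s => ∑ t, ‖U (σ s) f - U (σ t) f‖ ^ 2)
        (fun s _ => Finset.sum_nonneg fun t _ => by positivity) (Finset.mem_univ s))
      exact Finset.single_le_sum (f := fun t => ‖U (σ s) f - U (σ t) f‖ ^ 2)
        (fun t _ => by positivity) (Finset.mem_univ t)
    have hΔ0 : 0 ≤ Δ := Finset.sum_nonneg fun s _ => Finset.sum_nonneg fun t _ => by positivity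
    calc 2 * ‖f‖ ^ 2 ≤ ‖f - U g f‖ ^ 2 := hg
      _ ≤ (D * Real.sqrt Δ) ^ 2 := by gcongr
      _ = (D : ℝ) ^ 2 * Δ := by rw [mul_pow, Real.sq_sqrt hΔ0]
  -- the variance identity for the vectors `U (σ s) f`, which have the same length
  have hsum : ‖∑ s, U (σ s) f‖ ^ 2 = n ^ 2 * ‖f‖ ^ 2 - Δ / 2 := by
    have h3 : ∀ s t, ‖U (σ s) f - U (σ t) f‖ ^ 2 =
        2 * ‖f‖ ^ 2 - 2 * inner ℝ (U (σ s) f) (U (σ t) f) := by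
      intro s t
      rw [norm_sub_sq_real, LinearIsometryEquiv.norm_map, LinearIsometryEquiv.norm_map]
      ring
    have h4 : Δ = n ^ 2 * (2 * ‖f‖ ^ 2) - 2 * ‖∑ s, U (σ s) f‖ ^ 2 := by
      rw [hΔ, ← real_inner_self_eq_norm_sq (∑ s, U (σ s) f), sum_inner]
      simp only [h3, Finset.sum_sub_distrib, inner_sum, ← Finset.mul_sum, Finset.sum_const,
        Finset.card_univ, nsmul_eq_mul, ← hn]
      ring
    linarith
  rw [avgOp_apply, norm_smul, mul_pow, hsum, ← hn, norm_inv, Real.norm_of_nonneg hn0.le]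
  have h5 : 2 * ‖f‖ ^ 2 / (D : ℝ) ^ 2 ≤ Δ := by
    rw [div_le_iff₀ (by positivity)]
    linarith
  have h6 : n⁻¹ ^ 2 * (n ^ 2 * ‖f‖ ^ 2 - Δ / 2) = ‖f‖ ^ 2 - Δ / (2 * n ^ 2) := by
    field_simp
  have h7 : (1 - 1 / (n ^ 2 * (D : ℝ) ^ 2)) * ‖f‖ ^ 2 =
      ‖f‖ ^ 2 - 2 * ‖f‖ ^ 2 / (D : ℝ) ^ 2 / (2 * n ^ 2) := by
    field_simp
  rw [h6, h7]
  gcongr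

theorem norm_avgOp_pow_sq_le [Fintype Q] [Nonempty ι] (U : Q →* (E ≃ₗᵢ[ℝ] E)) (σ : ι → Q) {D : ℕ}
    (hD : 1 ≤ D) (hgen : ∀ g : Q, g ∈ {x | ∃ s t, (σ s)⁻¹ * σ t = x} ^ D) (l : ℕ) {f : E}
    (hf : ∑ g, U g f = 0) :
    ‖(avgOp U σ ^ l) f‖ ^ 2 ≤
      (1 - 1 / ((Fintype.card ι : ℝ) ^ 2 * (D : ℝ) ^ 2)) ^ l * ‖f‖ ^ 2 := by
  have hn : (1 : ℝ) ≤ Fintype.card ι := by exact_mod_cast Fintype.card_pos (α := ι)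
  have hD' : (1 : ℝ) ≤ D := by exact_mod_cast hD
  have hρ : 0 ≤ 1 - 1 / ((Fintype.card ι : ℝ) ^ 2 * (D : ℝ) ^ 2) := by
    rw [sub_nonneg, div_le_one (by positivity)]
    exact one_le_mul_of_one_le_of_one_le (one_le_pow₀ hn) (one_le_pow₀ hD')
  induction l generalizing f with
  | zero => simp
  | succ l ih =>
    rw [pow_succ (avgOp U σ), Module.End.mul_apply]
    calc _ ≤ _ := ih (sum_avgOp_eq_zero U σ hf)
      _ ≤ _ := mul_le_mul_of_nonneg_left (norm_avgOp_sq_le U σ hD hgen hf) (pow_nonneg hρ l)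
      _ = _ := by ring

end Contraction

/-! ### Random walks on finite groups -/

section FiniteGroup

variable {Q ι : Type*} [Group Q] [Fintype Q] [Fintype ι]

/-- The left regular representation of a finite group on its real functions. -/
noncomputable def regularRep (Q : Type*) [Group Q] [Fintype Q] :
    Q →* (EuclideanSpace ℝ Q ≃ₗᵢ[ℝ] EuclideanSpace ℝ Q) where
  toFun g := LinearIsometryEquiv.piLpCongrLeft 2 ℝ ℝ (Equiv.mulLeft g)
  map_one' := by
    ext f x
    change f ((Equiv.mulLeft (1 : Q)).symm x) = f x
    simp
  map_mul' g h := by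
    ext f x
    change f ((Equiv.mulLeft (g * h)).symm x) =
      f ((Equiv.mulLeft h).symm ((Equiv.mulLeft g).symm x))
    simp [mul_assoc]

theorem regularRep_apply (g : Q) (f : EuclideanSpace ℝ Q) (x : Q) :
    regularRep Q g f x = f (g⁻¹ * x) := by
  simp [regularRep, LinearIsometryEquiv.piLpCongrLeft_apply]

theorem sum_regularRep_apply (f : EuclideanSpace ℝ Q) (x : Q) :
    (∑ g, regularRep Q g f) x = ∑ y, f y := by
  rw [WithLp.ofLp_sum, Finset.sum_apply,
    ← Equiv.sum_comp ((Equiv.inv Q).trans (Equiv.mulRight x)) fun y => f y]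
  simp [regularRep_apply]

theorem avgOp_pow_single [DecidableEq Q] (σ : ι → Q) (l : ℕ) :
    (avgOp (regularRep Q) σ ^ l) (EuclideanSpace.single 1 (1 : ℝ)) =
      ((Fintype.card ι : ℝ) ^ l)⁻¹ • ∑ t : Fin l → ι,
        EuclideanSpace.single (List.ofFn fun i => σ (t i)).prod (1 : ℝ) := by
  have hU : ∀ g x : Q, regularRep Q g (EuclideanSpace.single x (1 : ℝ)) =
      EuclideanSpace.single (g * x) 1 := by
    intro g x
    ext y
    rw [regularRep_apply]
    simp [inv_mul_eq_iff_eq_mul]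
  induction l with
  | zero => simp
  | succ l ih =>
    rw [pow_succ', Module.End.mul_apply, ih, map_smul, avgOp_apply, smul_smul, ← mul_inv,
      ← pow_succ]
    congr 1
    rw [← (Fin.consEquiv fun _ : Fin (l + 1) => ι).sum_comp, Fintype.sum_prod_type]
    refine Finset.sum_congr rfl fun s _ => ?_
    rw [map_sum]
    refine Finset.sum_congr rfl fun t _ => ?_
    rw [hU]
    simp [Fin.consEquiv, List.ofFn_succ]

/-- The random walk on a finite group approaches the uniform distribution at a rate given by the
number of factors `(σ s)⁻¹ * σ t` needed to write all elements. -/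
theorem abs_card_walk_sub_le [DecidableEq Q] [Nonempty ι] (σ : ι → Q) {D : ℕ}
    (hD : 1 ≤ D) (hgen : ∀ g : Q, g ∈ {x | ∃ s t, (σ s)⁻¹ * σ t = x} ^ D) (l : ℕ) (x : Q) :
    |((Finset.univ.filter fun t : Fin l → ι => (List.ofFn fun i => σ (t i)).prod = x).card : ℝ) /
        (Fintype.card ι : ℝ) ^ l - 1 / (Fintype.card Q : ℝ)| ≤
      Real.exp (-(l / (2 * (Fintype.card ι : ℝ) ^ 2 * (D : ℝ) ^ 2))) := by
  set n : ℝ := (Fintype.card ι : ℝ) with hn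
  set N : ℝ := (Fintype.card Q : ℝ) with hN
  have hn0 : 0 < n := by rw [hn]; exact_mod_cast Fintype.card_pos
  have hN0 : 0 < N := by rw [hN]; exact_mod_cast Fintype.card_pos
  set δ : EuclideanSpace ℝ Q := EuclideanSpace.single 1 (1 : ℝ) with hδ
  set u : EuclideanSpace ℝ Q := WithLp.toLp 2 (fun _ => 1 / N) with hu
  have hux : ∀ y, u y = 1 / N := fun y => rfl
  have hAu : ∀ k : ℕ, (avgOp (regularRep Q) σ ^ k) u = u := by
    intro k
    induction k with
    | zero => simp
    | succ k ih =>
      rw [pow_succ, Module.End.mul_apply]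
      have : avgOp (regularRep Q) σ u = u := by
        have h1 : ∀ g, regularRep Q g u = u := by
          intro g; ext y; rw [regularRep_apply, hux]
        rw [avgOp_apply]
        simp only [h1, Finset.sum_const, Finset.card_univ, ← Nat.cast_smul_eq_nsmul ℝ]
        rw [smul_smul, ← hn, inv_mul_cancel₀ hn0.ne', one_smul]
      rw [this, ih]
  have hmean : ∑ g, regularRep Q g (δ - u) = 0 := by
    ext y
    rw [sum_regularRep_apply]
    have h1 : ∑ z, δ z = 1 := by simp [hδ]
    have h2 : ∑ z, u z = 1 := by
      simp only [hux, Finset.sum_const, Finset.card_univ, nsmul_eq_mul, ← hN]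
      field_simp
    simp [h1, h2]
  have hnorm : ‖δ - u‖ ^ 2 ≤ 1 := by
    have h1 : ‖δ‖ = 1 := by simp [hδ]
    have h2 : inner ℝ δ u = 1 / N := by simp [hδ, EuclideanSpace.inner_single_left, hux]
    have h3 : ‖u‖ ^ 2 = 1 / N := by
      rw [EuclideanSpace.norm_sq_eq]
      simp only [hux, Finset.sum_const, Finset.card_univ, nsmul_eq_mul, ← hN, Real.norm_eq_abs,
        sq_abs]
      field_simp
    rw [norm_sub_sq_real, h1, h2, h3]
    have : 0 < 1 / N := by positivity
    linarith
  have hval : ((Finset.univ.filter fun t : Fin l → ι =>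
      (List.ofFn fun i => σ (t i)).prod = x).card : ℝ) / n ^ l - 1 / N =
      ((avgOp (regularRep Q) σ ^ l) (δ - u)) x := by
    rw [map_sub, hAu, avgOp_pow_single, PiLp.sub_apply, hux, PiLp.smul_apply, WithLp.ofLp_sum,
      Finset.sum_apply]
    simp only [PiLp.single_apply, Finset.sum_boole, smul_eq_mul, ← hn, eq_comm (a := x)]
    rw [div_eq_inv_mul]
  rw [hval]
  have hle : |((avgOp (regularRep Q) σ ^ l) (δ - u)) x| ^ 2 ≤
      ‖(avgOp (regularRep Q) σ ^ l) (δ - u)‖ ^ 2 := by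
    have := PiLp.norm_apply_le ((avgOp (regularRep Q) σ ^ l) (δ - u)) x
    rw [Real.norm_eq_abs] at this
    gcongr
  have hcontr := norm_avgOp_pow_sq_le (regularRep Q) σ hD hgen l hmean
  refine le_of_sq_le_sq ?_ (Real.exp_pos _).le
  have hn1 : 1 ≤ n := by rw [hn]; exact_mod_cast Fintype.card_pos (α := ι)
  have hD' : (1 : ℝ) ≤ D := by exact_mod_cast hD
  have hρ : 0 ≤ 1 - 1 / (n ^ 2 * (D : ℝ) ^ 2) := by
    rw [sub_nonneg, div_le_one (by positivity)]
    exact one_le_mul_of_one_le_of_one_le (one_le_pow₀ hn1) (one_le_pow₀ hD')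
  calc _ ≤ _ := hle
    _ ≤ _ := hcontr
    _ ≤ (1 - 1 / (n ^ 2 * (D : ℝ) ^ 2)) ^ l * 1 := by gcongr
    _ ≤ Real.exp (-(1 / (n ^ 2 * (D : ℝ) ^ 2))) ^ l * 1 := by
        gcongr
        linarith [Real.add_one_le_exp (-(1 / (n ^ 2 * (D : ℝ) ^ 2)))]
    _ = Real.exp (-(l / (2 * n ^ 2 * (D : ℝ) ^ 2))) ^ 2 := by
        rw [mul_one, ← Real.exp_nat_mul, ← Real.exp_nat_mul]
        congr 1
        push_cast
        field_simp

end FiniteGroup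

/-! ### Indices of congruence subgroups and the adic norm -/

section Index

variable {R : Type*} [CommRing R] [IsDomain R] [IsDiscreteValuationRing R] {d : ℕ}

/-- A basis of `𝓜^(d)` consists of vectors of level one: hence the shift by one between levels
and the powers of `𝓜` containing the coordinates. -/
theorem mem_filt_succ_iff_repr (x : Module.Basis (Fin d) R (MaxTuple R d)) {n : ℕ}
    {v : MaxTuple R d} :
    v ∈ filt R d (n + 1) ↔ ∀ i, x.repr v i ∈ IsLocalRing.maximalIdeal R ^ n := by
  obtain ⟨ϖ, hϖ⟩ := IsDiscreteValuationRing.exists_irreducible R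
  have hϖm : ϖ ∈ IsLocalRing.maximalIdeal R := by
    rw [hϖ.maximalIdeal_eq]; exact Ideal.mem_span_singleton_self ϖ
  constructor
  · intro hv i
    obtain ⟨w, rfl⟩ := exists_smul_of_mem_filt hϖ.maximalIdeal_eq hv
    rw [map_smul, Finsupp.smul_apply, smul_eq_mul]
    exact Ideal.mul_mem_right _ _ (Ideal.pow_mem_pow hϖm n)
  · intro h
    rw [← x.sum_repr v]
    refine Submodule.sum_mem _ fun i _ j => ?_
    rw [pow_succ]
    exact Ideal.mul_mem_mul (h i) (x i j).2

theorem card_quotient_maximalIdeal_pow (R : Type*) [CommRing R] [IsDomain R]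
    [IsDiscreteValuationRing R] (n : ℕ) :
    Nat.card (R ⧸ IsLocalRing.maximalIdeal R ^ n) =
      Nat.card (IsLocalRing.ResidueField R) ^ n := by
  have := cardQuot_pow_of_prime (P := IsLocalRing.maximalIdeal R)
    (IsDiscreteValuationRing.not_a_field R) (i := n)
  rwa [Submodule.cardQuot_apply, Submodule.cardQuot_apply] at this

theorem adicNorm_le_pow_iff {c : ℝ} (hc0 : 0 < c) (hc1 : c < 1) (a : R) (n : ℕ) :
    adicNorm c a ≤ c ^ n ↔ a ∈ IsLocalRing.maximalIdeal R ^ n := by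
  by_cases ha : a = 0
  · subst ha
    simp only [adicNorm_zero, zero_mem, iff_true]
    positivity
  have hex : ∃ k, a ∉ IsLocalRing.maximalIdeal R ^ k := by
    by_contra! hk
    have h0 : a ∈ ⨅ n, IsLocalRing.maximalIdeal R ^ n := by
      rw [Ideal.mem_iInf]; exact hk
    rw [Ideal.iInf_pow_eq_bot_of_isLocalRing _ (IsLocalRing.maximalIdeal.isMaximal R).ne_top,
      Ideal.mem_bot] at h0
    exact ha h0
  classical
  obtain ⟨m, hm⟩ : ∃ m, Nat.find hex = m + 1 := by
    refine Nat.exists_eq_succ_of_ne_zero fun h => ?_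
    have := Nat.find_spec hex
    rw [h] at this
    simp at this
  have h1 : a ∈ IsLocalRing.maximalIdeal R ^ m := by
    have := Nat.find_min hex (m := m) (by omega)
    rwa [not_not] at this
  have h2 : a ∉ IsLocalRing.maximalIdeal R ^ (m + 1) := hm ▸ Nat.find_spec hex
  rw [adicNorm_eq c h1 h2, pow_le_pow_iff_right_of_lt_one₀ hc0 hc1]
  constructor
  · intro h
    exact Ideal.pow_le_pow_right h h1
  · intro h
    by_contra hlt
    exact h2 (Ideal.pow_le_pow_right (by omega) h)

variable [TopologicalSpace R] {G : Type*} [Group G] [TopologicalSpace G]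
  (Γ : StandardStructure R d G)

theorem StandardStructure.card_quotient_level (hR : IsAdic (IsLocalRing.maximalIdeal R)) (n : ℕ) :
    Nat.card (G ⧸ Γ.level hR (n + 1)) = Nat.card (IsLocalRing.ResidueField R) ^ (d * n) := by
  obtain ⟨x⟩ := nonempty_basis_maxTuple R d
  set Ψ : G → Fin d → R ⧸ IsLocalRing.maximalIdeal R ^ n := fun g i =>
    Ideal.Quotient.mk _ (x.repr (Γ.coord g) i) with hΨ
  have hiff : ∀ g h, Ψ g = Ψ h ↔ g⁻¹ * h ∈ Γ.level hR (n + 1) := by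
    intro g h
    rw [Γ.inv_mul_mem_level_iff hR, mem_filt_succ_iff_repr x, eq_comm, funext_iff]
    refine forall_congr' fun i => ?_
    rw [hΨ, Ideal.Quotient.eq, map_sub, Finsupp.sub_apply]
  have hsurj : Function.Surjective Ψ := by
    intro y
    choose a ha using fun i => Ideal.Quotient.mk_surjective (y i)
    refine ⟨Γ.coord.symm (∑ i, a i • x i), funext fun i => ?_⟩
    simp only [hΨ, Homeomorph.apply_symm_apply, x.repr_sum_self, ha]
  let Φ : G ⧸ Γ.level hR (n + 1) → Fin d → R ⧸ IsLocalRing.maximalIdeal R ^ n := fun z =>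
    Quotient.liftOn' z Ψ fun g h hgh => (hiff g h).2 (QuotientGroup.leftRel_apply.1 hgh)
  have hΦ : Function.Bijective Φ := by
    constructor
    · intro z w
      induction z using QuotientGroup.induction_on
      induction w using QuotientGroup.induction_on
      intro h
      exact QuotientGroup.eq.2 ((hiff _ _).1 h)
    · intro y
      obtain ⟨g, hg⟩ := hsurj y
      exact ⟨(g : G ⧸ Γ.level hR (n + 1)), hg⟩
  rw [Nat.card_congr (Equiv.ofBijective Φ hΦ), Nat.card_fun, card_quotient_maximalIdeal_pow,
    Nat.card_fin, ← pow_mul, mul_comm]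

theorem StandardStructure.finite_quotient_level [Finite (IsLocalRing.ResidueField R)]
    (hR : IsAdic (IsLocalRing.maximalIdeal R)) (n : ℕ) : Finite (G ⧸ Γ.level hR (n + 1)) := by
  refine Nat.finite_of_card_ne_zero ?_
  rw [Γ.card_quotient_level hR]
  exact pow_ne_zero _ Nat.card_pos.ne'

theorem StandardStructure.t1Space [IsTopologicalGroup G] (Γ : StandardStructure R d G)
    (hR : IsAdic (IsLocalRing.maximalIdeal R)) : T1Space G := by
  refine t1Space_iff_exists_open.2 fun g h hgh => ?_
  have hn : ∃ n, g⁻¹ * h ∉ Γ.level hR n := by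
    by_contra! hc
    refine hgh (Γ.coord.injective (funext fun i => Subtype.ext ?_))
    have h0 : (Γ.coord h i : R) - Γ.coord g i ∈ ⨅ n, IsLocalRing.maximalIdeal R ^ n := by
      rw [Ideal.mem_iInf]
      intro n
      exact (Γ.inv_mul_mem_level_iff hR).1 (hc n) i
    rw [Ideal.iInf_pow_eq_bot_of_isLocalRing _ (IsLocalRing.maximalIdeal.isMaximal R).ne_top,
      Ideal.mem_bot, sub_eq_zero] at h0
    exact h0.symm
  obtain ⟨n, hn⟩ := hn
  exact ⟨(fun z => g⁻¹ * z) ⁻¹' (Γ.level hR n),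
    (Γ.isOpen_level hR n).preimage (continuous_const.mul continuous_id), by simp, hn⟩

end Index

/-! ### The law of the random walk -/

section Walk

variable {Ω G : Type*} [MeasurableSpace Ω] [Group G] [MeasurableSpace G]
  [MeasurableSingletonClass G] {P : Measure Ω} {S : Finset G}
  {hS : S.Nonempty} {X : ℕ → Ω → G}

open Classical in
/-- The law of the simple random walk, as a proportion of words. The set `A` need not be
measurable. -/
theorem measureReal_walk_mem (hind : iIndepFun X P)
    (hlaw : ∀ i, HasLaw (X i) (PMF.uniformOfFinset S hS).toMeasure P) (l : ℕ) (A : Set G) :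
    P.real {ω | walk X l ω ∈ A} =
      ((Finset.univ.filter fun t : Fin l → S => (List.ofFn fun i => (t i : G)).prod ∈ A).card : ℝ) /
        (Fintype.card S : ℝ) ^ l := by
  set W := Finset.univ.filter fun t : Fin l → S => (List.ofFn fun i => (t i : G)).prod ∈ A with hW
  set B : (Fin l → S) → Set Ω := fun t => ⋂ i : Fin l, X i ⁻¹' {(t i : G)} with hB
  have hsing : ∀ (i : ℕ) (s : S), P (X i ⁻¹' {(s : G)}) = (Fintype.card S : ENNReal)⁻¹ := by
    intro i s
    rw [← Measure.map_apply_of_aemeasurable (hlaw i).aemeasurable (measurableSet_singleton _),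
      (hlaw i).map_eq, PMF.toMeasure_apply_singleton _ _ (measurableSet_singleton _),
      PMF.uniformOfFinset_apply_of_mem hS s.2, Fintype.card_coe]
  have hPB : ∀ t, P (B t) = ((Fintype.card S : ENNReal)⁻¹) ^ l := by
    intro t
    have h1 : iIndepFun (fun i : Fin l => X i) P := hind.precomp Fin.val_injective
    have h2 := h1.measure_inter_preimage_eq_mul Finset.univ
      (sets := fun i => {(t i : G)}) fun i _ => measurableSet_singleton _
    simp only [Finset.mem_univ, Set.iInter_true, hsing, Finset.prod_const, Finset.card_univ,
      Fintype.card_fin] at h2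
    exact h2
  have hsupp : ∀ᵐ ω ∂P, ∀ i, X i ω ∈ S := by
    rw [ae_all_iff]
    intro i
    have h1 : ∀ᵐ g ∂(PMF.uniformOfFinset S hS).toMeasure, g ∈ S := by
      rw [ae_iff]
      change (PMF.uniformOfFinset S hS).toMeasure (S : Set G)ᶜ = 0
      rw [PMF.toMeasure_apply_eq_zero_iff _ S.measurableSet.compl, PMF.support_uniformOfFinset]
      exact disjoint_compl_right
    rw [← (hlaw i).map_eq] at h1
    exact ae_of_ae_map (hlaw i).aemeasurable h1
  -- up to a null set, the event is a disjoint union over the words whose product is in `A`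
  have hae : {ω | walk X l ω ∈ A} =ᵐ[P] ⋃ t ∈ W, B t := by
    filter_upwards [hsupp] with ω hω
    refine propext ?_
    change walk X l ω ∈ A ↔ ω ∈ ⋃ t ∈ W, B t
    simp only [Set.mem_iUnion, hB, Set.mem_iInter, Set.mem_preimage, Set.mem_singleton_iff,
      exists_prop, hW, Finset.mem_filter, Finset.mem_univ, true_and]
    constructor
    · intro h
      exact ⟨fun i => ⟨X i ω, hω i⟩, h, fun i => rfl⟩
    · rintro ⟨t, ht, h⟩
      simpa only [walk, h] using ht
  have hdisj : Set.Pairwise (W : Set (Fin l → S)) (Function.onFun (AEDisjoint P) B) := by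
    intro t _ t' _ hne
    refine Disjoint.aedisjoint (Set.disjoint_left.2 fun ω h h' => hne (funext fun i => ?_))
    simp only [hB, Set.mem_iInter, Set.mem_preimage, Set.mem_singleton_iff] at h h'
    exact Subtype.ext ((h i).symm.trans (h' i))
  have hmeas : ∀ t ∈ W, NullMeasurableSet (B t) P := fun t _ =>
    NullMeasurableSet.iInter fun i =>
      (hlaw i).aemeasurable.nullMeasurable (measurableSet_singleton _)
  rw [measureReal_def, measure_congr hae, measure_biUnion_finset₀ hdisj hmeas]
  simp only [hPB, Finset.sum_const, nsmul_eq_mul]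
  simp [div_eq_mul_inv]

end Walk

/-! ### Diameters of the congruence quotients and mixing -/

section Covering

variable {R : Type*} [CommRing R] [IsDomain R] [IsDiscreteValuationRing R] [TopologicalSpace R]
  [Finite (IsLocalRing.ResidueField R)] {p : ℕ} [CharP (IsLocalRing.ResidueField R) p]
  {d : ℕ} {G : Type*} [Group G] [TopologicalSpace G] (Γ : StandardStructure R d G)

/-- The index of a congruence subgroup is a power of the residue characteristic. -/
theorem StandardStructure.eq_two_of_index_eq_two (hp : p.Prime)
    (hR : IsAdic (IsLocalRing.maximalIdeal R)) {n : ℕ} {H : Subgroup G}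
    (hH : Γ.level hR (n + 1) ≤ H) (hH2 : H.index = 2) : p = 2 := by
  have h1 := Subgroup.index_dvd_of_le hH
  rw [hH2, Subgroup.index, Γ.card_quotient_level hR] at h1
  have h2 := Nat.prime_two.dvd_of_dvd_pow h1
  have := Fintype.ofFinite (IsLocalRing.ResidueField R)
  obtain ⟨k, -, hk⟩ := FiniteField.card (IsLocalRing.ResidueField R) p
  rw [Nat.card_eq_fintype_card, hk] at h2
  exact ((Nat.prime_dvd_prime_iff_eq Nat.prime_two hp).1
    (Nat.prime_two.dvd_of_dvd_pow h2)).symm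

/-- The exponent of the polynomial bound on diameters. A step multiplies lengths by `4 * d + 1`, and
precisions by at least `7 / 6`, a value below `5 / 4` that leaves room for rounding. -/
noncomputable def diamExponent (d : ℕ) : ℝ := Real.log (4 * d + 1 : ℕ) / Real.log (7 / 6)

theorem diamExponent_nonneg (d : ℕ) : 0 ≤ diamExponent d :=
  div_nonneg (Real.log_nonneg (by exact_mod_cast Nat.le_add_left 1 (4 * d)))
    (Real.log_nonneg (by norm_num))

/-- Polylogarithmic diameters: every class modulo `𝓜 ^ n` is a product of polynomially many
(in `n`) elements of `S * S`. The set `S * S` contains `1`, so that exact lengths suffice. The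
factor `L` is the same for all `S`, since only the subsets of a single finite quotient of `G`
matter. -/
theorem StandardStructure.exists_covers [IsTopologicalGroup G] (hp : p.Prime)
    (hR : IsAdic (IsLocalRing.maximalIdeal R)) (hF : Γ.law.LiePerfect) :
    ∃ L : ℕ, 1 ≤ L ∧ ∀ S : Set G, S.Nonempty → (∀ s ∈ S, s⁻¹ ∈ S) →
      Dense (Subgroup.closure S : Set G) →
      (p = 2 → ∀ H : Subgroup G, IsOpen (H : Set G) → H.index = 2 → ∃ s ∈ S, s ∈ H) →
      ∀ n : ℕ, 1 ≤ n → ∃ ℓ : ℕ, 1 ≤ ℓ ∧ Γ.Covers (S * S) ℓ n ∧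
        (ℓ : ℝ) ≤ L * (n : ℝ) ^ diamExponent d := by
  obtain ⟨n₀, hstep⟩ := Γ.exists_covers_step hR hF
  have hfin := Γ.finite_quotient_level hR (2 * n₀ + 99)
  obtain ⟨L, hL1, hL⟩ := exists_forall_mem_pow (G ⧸ Γ.level hR (2 * n₀ + 100))
  refine ⟨L, hL1, fun S hne hS hdense hpar n hn => ?_⟩
  have hSinv : S⁻¹ = S := by
    ext x
    exact ⟨fun h => by simpa using hS _ h, fun h => hS _ h⟩
  have hTinv : (S * S)⁻¹ = S * S := by rw [mul_inv_rev, hSinv]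
  obtain ⟨s₀, hs₀⟩ := id hne
  have hT1 : (1 : G) ∈ S * S := ⟨s₀, hs₀, s₀⁻¹, hS _ hs₀, mul_inv_cancel s₀⟩
  have hgen := closure_image_mul_self_eq_top hne hS hdense (Γ.level hR (2 * n₀ + 100))
    (Γ.isOpen_level hR _) fun H hH hH2 =>
      hpar (Γ.eq_two_of_index_eq_two hp hR hH hH2) H
        (Subgroup.isOpen_mono hH (Γ.isOpen_level hR _)) hH2
  have hbase : Γ.Covers (S * S) L (2 * n₀ + 100) := by
    intro g
    have h1 := hL (QuotientGroup.mk' (Γ.level hR (2 * n₀ + 100)) '' (S * S))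
      (by rw [← Set.image_inv, hTinv]) ⟨1, hT1, map_one _⟩ hgen
      (QuotientGroup.mk' (Γ.level hR (2 * n₀ + 100)) g)
    rw [← Set.image_pow] at h1
    obtain ⟨t, ht, htg⟩ := h1
    exact ⟨t, ht, (Γ.inv_mul_mem_level_iff hR).1 (QuotientGroup.eq.1 htg)⟩
  obtain ⟨ℓ, ⟨h1, h2⟩, h3⟩ := exists_le_mul_rpow_of_step
    (P := fun ℓ n => 1 ≤ ℓ ∧ Γ.Covers (S * S) ℓ n) (K := 4 * d + 1) (n₀ := n₀)
    (by omega)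
    (fun ℓ n m hmn h => ⟨h.1, fun g => by
      obtain ⟨t, ht, htg⟩ := h.2 g
      exact ⟨t, ht, filt_antitone hmn htg⟩⟩)
    (fun ℓ n hn h => ⟨Nat.mul_pos (by omega) h.1, hstep _ hTinv ℓ n hn h.2⟩)
    ⟨hL1, hbase⟩ hn
  exact ⟨ℓ, h1, h2, h3⟩

end Covering

/-- Mixing of the random walk in coordinates, in terms of the number `D` of factors needed to
represent all classes modulo `𝓜 ^ (N + 1)`. -/
theorem StandardStructure.abs_measureReal_walk_sub_le
    {R : Type*} [CommRing R] [IsDomain R] [IsDiscreteValuationRing R] [TopologicalSpace R]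
    [Finite (IsLocalRing.ResidueField R)] {d : ℕ} {G : Type*} [Group G] [TopologicalSpace G]
    [IsTopologicalGroup G] [MeasurableSpace G] [BorelSpace G] (Γ : StandardStructure R d G)
    (hR : IsAdic (IsLocalRing.maximalIdeal R)) {S : Finset G} (hS : S.Nonempty)
    (hsymm : ∀ s ∈ S, s⁻¹ ∈ S) {D N : ℕ} (hD : 1 ≤ D)
    (hcov : Γ.Covers ((S : Set G) * S) D (N + 1))
    (x : Module.Basis (Fin d) R (MaxTuple R d)) {c : ℝ} (hc0 : 0 < c) (hc1 : c < 1)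
    {Ω : Type*} [MeasurableSpace Ω] {P : Measure Ω} {X : ℕ → Ω → G}
    (hind : iIndepFun X P)
    (hlaw : ∀ i, HasLaw (X i) (PMF.uniformOfFinset S hS).toMeasure P)
    (lam : Fin d → R) (l : ℕ) :
    |P.real {ω | ∀ i, adicNorm c (x.repr (Γ.coord (walk X l ω)) i - lam i) ≤ c ^ N} -
        1 / (Nat.card (IsLocalRing.ResidueField R) : ℝ) ^ (d * N)| ≤
      Real.exp (-(l / (2 * (S.card : ℝ) ^ 2 * (D : ℝ) ^ 2))) := by
  have := Γ.t1Space hR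
  have hfin := Γ.finite_quotient_level hR N
  classical
  have := Fintype.ofFinite (G ⧸ Γ.level hR (N + 1))
  have := hS.to_subtype
  set π := QuotientGroup.mk' (Γ.level hR (N + 1)) with hπ
  -- the event is that the walk lies in a given coset of a congruence subgroup
  set g₀ : G := Γ.coord.symm (∑ i, lam i • x i) with hg₀
  have hevent : {ω | ∀ i, adicNorm c
      (x.repr (Γ.coord (walk X l ω)) i - lam i) ≤ c ^ N} =
      {ω | walk X l ω ∈ π ⁻¹' {π g₀}} := by
    ext ω
    simp only [Set.mem_ofPred_eq, Set.mem_preimage, Set.mem_singleton_iff]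
    rw [eq_comm, hπ, QuotientGroup.mk'_apply, QuotientGroup.mk'_apply, QuotientGroup.eq,
      Γ.inv_mul_mem_level_iff hR, mem_filt_succ_iff_repr x]
    refine forall_congr' fun i => ?_
    rw [adicNorm_le_pow_iff hc0 hc1, map_sub, Finsupp.sub_apply, hg₀, Homeomorph.apply_symm_apply,
      x.repr_sum_self]
  have hgen : ∀ z : G ⧸ Γ.level hR (N + 1),
      z ∈ {y | ∃ s t : S, (π (s : G))⁻¹ * π (t : G) = y} ^ D := by
    intro z
    obtain ⟨g, rfl⟩ := QuotientGroup.mk'_surjective _ z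
    obtain ⟨t, ht, htg⟩ := hcov g
    have h1 : π t ∈ (π '' ((S : Set G) * S)) ^ D := by
      rw [← Set.image_pow]; exact ⟨t, ht, rfl⟩
    have h2 : π t = π g := QuotientGroup.eq.2 ((Γ.inv_mul_mem_level_iff hR).2 htg)
    rw [← hπ, ← h2]
    refine Set.pow_subset_pow_left ?_ h1
    rintro _ ⟨_, ⟨a, ha, b, hb, rfl⟩, rfl⟩
    exact ⟨⟨a⁻¹, hsymm a ha⟩, ⟨b, hb⟩, by simp⟩
  have hmix := abs_card_walk_sub_le (fun s : S => π (s : G)) hD hgen l (π g₀)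
  have hcardQ : (Fintype.card (G ⧸ Γ.level hR (N + 1)) : ℝ) =
      (Nat.card (IsLocalRing.ResidueField R) : ℝ) ^ (d * N) := by
    rw [← Nat.card_eq_fintype_card, Γ.card_quotient_level hR]
    push_cast
    rfl
  have hprod : ∀ t : Fin l → S, (List.ofFn fun i => π (t i : G)).prod =
      π (List.ofFn fun i => (t i : G)).prod := by
    intro t
    rw [map_list_prod, List.map_ofFn]
    rfl
  rw [hevent, measureReal_walk_mem hind hlaw]
  simp only [hprod, hcardQ, Fintype.card_coe] at hmix
  simp only [Set.mem_preimage, Set.mem_singleton_iff, Fintype.card_coe]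
  exact hmix

end RStandard

theorem corollary1p7 (d : ℕ) :
    ∃ C : ℝ, 0 < C ∧ ∀ C' : ℝ, 0 < C' →
      -- `C₃` depends only on `d`, on the size `q` of the residue field, and on `C'`
      ∀ q : ℕ, ∃ C₃ : ℝ, 0 < C₃ ∧
        ∀ (p : ℕ), p.Prime →
        ∀ (R : Type*) [CommRing R] [IsDomain R] [IsDiscreteValuationRing R]
          [IsAdicComplete (IsLocalRing.maximalIdeal R) R]
          [Finite (IsLocalRing.ResidueField R)] [CharP (IsLocalRing.ResidueField R) p]
          [TopologicalSpace R],
        IsAdic (IsLocalRing.maximalIdeal R) →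
        Nat.card (IsLocalRing.ResidueField R) = q →
        ∀ (G : Type*) [Group G] [TopologicalSpace G] [IsTopologicalGroup G]
          [MeasurableSpace G] [BorelSpace G] (Γ : RStandard.StandardStructure R d G),
        Γ.law.LiePerfect →
        -- `C₂` depends only on `G`, on the cardinality `n` of `S`, and on `C'`
        ∀ n : ℕ, ∃ C₂ : ℝ, 0 < C₂ ∧
          ∀ (S : Finset G) (hS : S.Nonempty), S.card = n →
          (∀ s ∈ S, s⁻¹ ∈ S) →
          Dense (Subgroup.closure (S : Set G) : Set G) →
          -- no parity obstruction (relevant only in residue characteristic two)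
          (p = 2 → ∀ H : Subgroup G, IsOpen (H : Set G) → H.index = 2 → ∃ s ∈ S, s ∈ H) →
          ∀ (x : Module.Basis (Fin d) R (RStandard.MaxTuple R d))
            (c : ℝ), 0 < c → c < 1 →
          ∀ (Ω : Type*) [MeasurableSpace Ω] (P : Measure Ω) [IsProbabilityMeasure P]
            (X : ℕ → Ω → G),
          iIndepFun X P →
          (∀ i, HasLaw (X i) (PMF.uniformOfFinset S hS).toMeasure P) →
          ∀ (lam : Fin d → R) (N l : ℕ), C₂ * (N : ℝ) ^ (C + C') ≤ (l : ℝ) →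
            |P.real {ω | ∀ i, RStandard.adicNorm c
                  (x.repr (Γ.coord (RStandard.walk X l ω)) i - lam i) ≤ c ^ N}
                - 1 / (q : ℝ) ^ (d * N)|
              ≤ Real.exp (-(C₃ * (N : ℝ) ^ C')) := by
  -- mixing takes the square of the diameter, hence `2 * γ`; the `+ 1` only serves to make `C`
  -- positive when `d = 0`
  set γ := RStandard.diamExponent d with hγ
  have hγ0 : 0 ≤ γ := RStandard.diamExponent_nonneg d
  refine ⟨2 * γ + 1, by positivity, fun C' hC' q => ⟨1, one_pos, ?_⟩⟩
  intro p hp R _ _ _ _ _ _ _ hR hq G _ _ _ _ _ Γ hF n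
  obtain ⟨L, hL1, hL⟩ := Γ.exists_covers hp hR hF
  -- the factor `2 ^ γ` comes from `N + 1 ≤ 2 * N`
  refine ⟨2 * ((n : ℝ) + 1) ^ 2 * (L * 2 ^ γ) ^ 2, ?_, ?_⟩
  · have : (0 : ℝ) < L := by exact_mod_cast hL1
    positivity
  intro S hS hcard hsymm hdense hpar x c hc0 hc1 Ω _ P _ X hind hlaw lam N l hl
  obtain ⟨D, hD1, hcov, hDle⟩ := hL S hS hsymm hdense hpar (N + 1) (by omega)
  have hmix := Γ.abs_measureReal_walk_sub_le hR hS hsymm hD1 hcov x hc0 hc1 hind hlaw lam l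
  rw [hq, hcard] at hmix
  refine hmix.trans (Real.exp_le_exp.2 (neg_le_neg ?_))
  have hn0 : 0 < n := hcard ▸ hS.card_pos
  have hn0' : (0 : ℝ) < n := by exact_mod_cast hn0
  have hD0 : (0 : ℝ) < D := by exact_mod_cast hD1
  rw [one_mul, le_div_iff₀ (by positivity)]
  rcases Nat.eq_zero_or_pos N with rfl | hN
  · rw [Nat.cast_zero, Real.zero_rpow hC'.ne', zero_mul]
    positivity
  have hN1 : (1 : ℝ) ≤ N := by exact_mod_cast hN
  have hDN : (D : ℝ) ≤ L * 2 ^ γ * (N : ℝ) ^ γ := by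
    refine hDle.trans ?_
    rw [mul_assoc, ← Real.mul_rpow (by norm_num) (by positivity)]
    gcongr
    push_cast
    linarith
  calc (N : ℝ) ^ C' * (2 * (n : ℝ) ^ 2 * (D : ℝ) ^ 2)
      ≤ (N : ℝ) ^ C' * (2 * ((n : ℝ) + 1) ^ 2 * (L * 2 ^ γ * (N : ℝ) ^ γ) ^ 2) := by
        gcongr
        linarith
    _ = 2 * ((n : ℝ) + 1) ^ 2 * (L * 2 ^ γ) ^ 2 * (N : ℝ) ^ (2 * γ + C') := by
        rw [Real.rpow_add (by linarith), two_mul γ, Real.rpow_add (by linarith)]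
        ring
    _ ≤ 2 * ((n : ℝ) + 1) ^ 2 * (L * 2 ^ γ) ^ 2 * (N : ℝ) ^ (2 * γ + 1 + C') := by
        gcongr
        linarith
    _ ≤ l := hl
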